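/- **Definitions.** Let $(S;R)$ be a semigroup presentation: $R$ is a set of relations $u=v$ (unordered pairs) between nonempty words on $S$. Let $\equiv$ be the congruence on $S^*$ generated by $R$, and $\langle S;R\rangle^+=S^*/{\equiv}$. The presentation is *homogeneous* if there is a map $\lambda:S^*\to\mathbb N$, invariant under $\equiv$, with $\lambda(su)>\lambda(u)$ for all $s\in S$, $u\in S^*$. For words $w,w'$ on $S\cup S^{-1}$ write $w\curvearrowright_R w'$ if $w'$ is obtained from $w$ by finitely many steps, each of which either deletes a subword $u^{-1}u$ with $u\in S^*$ nonempty, or replaces a subword $u^{-1}v$ with $u,v\in S^*$ nonempty by $v'u'^{-1}$, where $uv'=vu'$ is a relation of $R$. The presentation is *R-complete* if $u\equiv v$ implies $u^{-1}v\curvearrowright_R\varepsilon$ for all $u,v\in S^*$. An *obstruction* of $R$ is a relation $su=tv$ with $s,t\in S$ and $u,v\in S^*$ such that $s^{-1}rr^{-1}t\curvearrowright_R uv^{-1}$ for some $r\in S$, but not $(su)^{-1}(tv)\curvearrowright_R\varepsilon$. A *run of the reversing completion* from $R$ is a sequence $R=P_0\subseteq P_1\subseteq P_2\subseteq\cdots$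 such that every relation in $P_{k+1}\setminus P_k$ is an obstruction of $P_k$, and such that whenever $s^{-1}rr^{-1}t\curvearrowright_{P_k}uv^{-1}$ for some $k$ (with $s,r,t\in S$ and $u,v\in S^*$), one has $(su)^{-1}(tv)\curvearrowright_{P_m}\varepsilon$ for some $m$. An *R-completion* of $R$ is the union $\bigcup_k P_k$ of such a run. **Proposition.** There exists a finite semigroup presentation that admits an infinite R-completion and whose monoid is nevertheless left and right cancellative. Precisely, the finite presentation $$(a,b,c,d;\ ab=bac,\ bc=cbd,\ da=ad,\ bd=db,\ dc=cd)$$ is homogeneous; it has exactly one R-completion (that is, all runs of the reversing completion have the same union), namely $$\{ab=bac,\ bc=cbd,\ da=ad,\ bd=db,\ dc=cd\}\cup\{\,b(ac)^nc=da^ncb\;:\;n\ge 0\,\};$$ this set is infinite and R-complete; and the monoid $\langle a,b,c,d;\ ab=bac,\ bc=cbd,\ da=ad,\ bd=db,\ dc=cd\rangle^+$ is both left and right cancellative. -/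

import Mathlib

namespace WordReversing

/-- A set of relations on words over `α`. A relation `u = v` is the unordered pair `s(u, v)`. -/
abbrev Rels (α : Type*) := Set (Sym2 (List α))

section General

variable {α : Type*}

/-- Both sides of every relation are nonempty words. -/
def IsSemigroupPresentation (R : Rels α) : Prop :=
  ∀ u v : List α, s(u, v) ∈ R → u ≠ [] ∧ v ≠ []

/-- The relations, seen as a binary relation on the free monoid. -/
def toRel (R : Rels α) (u v : FreeMonoid α) : Prop :=
  s(FreeMonoid.toList u, FreeMonoid.toList v) ∈ R

/-- `⟨α; R⟩⁺`, the quotient of the free monoid by the congruence generated by `R`. -/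
abbrev PresMonoid (R : Rels α) := PresentedMonoid (toRel R)

/-- `u ≡ v`: the words `u` and `v` represent the same element of the presented monoid. -/
def Equivalent (R : Rels α) (u v : List α) : Prop :=
  conGen (toRel R) (FreeMonoid.ofList u) (FreeMonoid.ofList v)

/-- Words on `α ∪ α⁻¹`: `(x, true)` is the letter `x` and `(x, false)` is the letter `x⁻¹`. -/
abbrev SignedWord (α : Type*) := List (α × Bool)

/-- A positive word seen as a signed word. -/
def pos (u : List α) : SignedWord α := u.map fun x => (x, true)

/-- The formal inverse `u⁻¹` of a positive word: `(s₁ … sₙ)⁻¹ = sₙ⁻¹ … s₁⁻¹`. -/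
def neg (u : List α) : SignedWord α := u.reverse.map fun x => (x, false)

/-- One step of word reversing: delete a subword `u⁻¹ u`, or replace a subword `u⁻¹ v` by
`v' u'⁻¹` where `u v' = v u'` is a relation; here `u` and `v` are nonempty words. -/
inductive RevStep (R : Rels α) : SignedWord α → SignedWord α → Prop
  | delete (x y : SignedWord α) (u : List α) (hu : u ≠ []) :
      RevStep R (x ++ neg u ++ pos u ++ y) (x ++ y)
  | replace (x y : SignedWord α) (u v u' v' : List α) (hu : u ≠ []) (hv : v ≠ [])
      (h : s(u ++ v', v ++ u') ∈ R) :
      RevStep R (x ++ neg u ++ pos v ++ y) (x ++ pos v' ++ neg u' ++ y)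

/-- `w ↷ w'`: the word `w` is reversible to `w'` in finitely many (possibly zero) steps. -/
def Reverses (R : Rels α) : SignedWord α → SignedWord α → Prop :=
  Relation.ReflTransGen (RevStep R)

/-- R-completeness: `u ≡ v` implies `u⁻¹ v ↷ ε`. -/
def RComplete (R : Rels α) : Prop :=
  ∀ u v : List α, Equivalent R u v → Reverses R (neg u ++ pos v) []

/-- The presentation admits a pseudolength. -/
def Homogeneous (R : Rels α) : Prop :=
  ∃ l : List α → ℕ, (∀ (s : α) (u : List α), l u < l (s :: u)) ∧
    ∀ u v : List α, Equivalent R u v → l u = l v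

/-- Reversing `s⁻¹ r r⁻¹ t` can produce `u v⁻¹`; this calls for the test `(su)⁻¹(tv) ↷ ε`. -/
def IsTest (R : Rels α) (s r t : α) (u v : List α) : Prop :=
  Reverses R (neg [s] ++ pos [r] ++ neg [r] ++ pos [t]) (pos u ++ neg v)

/-- The outcome of the test `(su)⁻¹(tv) ↷ ε`. -/
def PassesTest (R : Rels α) (s t : α) (u v : List α) : Prop :=
  Reverses R (neg (s :: u) ++ pos (t :: v)) []

/-- The relations `su = tv` coming from a test that fails: those that the completion procedure may
add to `R`. -/
def obstructions (R : Rels α) : Rels α :=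
  {p | ∃ (s r t : α) (u v : List α),
    IsTest R s r t u v ∧ ¬ PassesTest R s t u v ∧ p = s(s :: u, t :: v)}

/-- A run of the reversing-completion procedure starting from `R`: at each stage some of the
current obstructions (one, several or none) are added, and each test that ever shows up passes at
some stage. The order of the additions is left free. A terminating run is a run that is constant
from some stage on. -/
structure IsCompletionRun (R : Rels α) (P : ℕ → Rels α) : Prop where
  zero : P 0 = R
  mono : ∀ k, P k ⊆ P (k + 1)
  step : ∀ k, P (k + 1) ⊆ P k ∪ obstructions (P k)
  fair : ∀ (k : ℕ) (s r t : α) (u v : List α), IsTest (P k) s r t u v →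
    ∃ m, PassesTest (P m) s t u v

/-- `Q` is an R-completion of `R`: the set of all relations present at some stage of some run of
the completion procedure starting from `R`. -/
def IsRCompletion (R Q : Rels α) : Prop :=
  ∃ P : ℕ → Rels α, IsCompletionRun R P ∧ Q = ⋃ k, P k

end General

/-- The four generators. -/
inductive Gen
  | a | b | c | d

open Gen in
/-- The relations `ab = bac, bc = cbd, da = ad, bd = db, dc = cd`. -/
def baseRels : Rels Gen :=
  {s([a, b], [b, a, c]), s([b, c], [c, b, d]), s([d, a], [a, d]), s([b, d], [d, b]),
    s([d, c], [c, d])}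

open Gen in
/-- The relation `b (ac)ⁿ c = d aⁿ c b`. -/
def addedRel (n : ℕ) : Sym2 (List Gen) :=
  s([b] ++ (List.replicate n [a, c]).flatten ++ [c], [d] ++ List.replicate n a ++ [c, b])

end WordReversing

open WordReversing

/-! In the group with the same presentation, `d` is central and conjugation by `b` is the map `φ : a
↦ ac, c ↦ cd⁻¹`. Pushing every `b` to the left therefore gives each word a form `bᵏ w dᵉ` with `w` a
word in `a, c` and `e` an integer. Each generator acts injectively on these forms by left
multiplication, which gives left cancellation. Right multiplication by a generator is also injective
on them, because `φ` is injective on words in `a, c`.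

The forms that come from positive words are those with `e ≥ -depth k w`, where `depth k w` is the
largest number of `d⁻¹` that moving the `b`s can create. This description (`valid_normalForm`,
`exists_normalForm_eq`) settles when `su` and `tv` have the same normal form: such an equality
factors through a relation `sp = tq` (`lcmStep`). The pair `b, d` is the only one needing more than
the base relations. There, failure of `bd = db` means that `depth` jumps from `k` to `k + 1`, which
forces `w` to begin with `(acᵏ⁺¹)ⁿc`, and the relation needed is exactly `addedRel n`. Here `n` is
at most the number of letters `a`, an invariant of the congruence.

Induction on a pseudolength turns this into a graded completeness statement
(`grid_of_normalForm_eq`): with the added relations of index below `N`, equivalent words with fewer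
than `N` letters `a` pass the reversing test. With all of them, the presentation is complete and
normal forms decide the congruence.

For the runs, suppose the added relations present are those of index below `N`. Short tests pass by
graded completeness, and a case analysis of the rest leaves `addedRel N` as the only possible
obstruction. Hence every stage of every run is an initial segment of the added relations. Fairness
forces each of them in, since `addedRel 0` comes from `b, c, d`, `addedRel (n + 1)` comes from
`addedRel n` through `b, a, d`, and the test for `addedRel n` passes only once `addedRel n` is
present. -/

namespace WordReversing

/-! ### Reversing grids -/

section Grid

variable {α : Type*}

/-- An elementary cell: `s⁻¹ t` reverses to `p q⁻¹` in one step. -/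
def Cell (R : Rels α) (s t : α) (p q : List α) : Prop :=
  (s = t ∧ p = [] ∧ q = []) ∨ s(s :: p, t :: q) ∈ R

/-- Reversing grids: `Grid R u v v' u'` says that `u⁻¹ v` reverses to `v' u'⁻¹`. -/
inductive Grid (R : Rels α) : List α → List α → List α → List α → Prop
  | nil_left (v : List α) : Grid R [] v v []
  | nil_right (u : List α) : Grid R u [] [] u
  | cell {s t : α} {p q : List α} (h : Cell R s t p q) : Grid R [s] [t] p q
  | hcomp {u x x' u₁ y y' u₂ : List α} (h₁ : Grid R u x x' u₁) (h₂ : Grid R u₁ y y' u₂) :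
      Grid R u (x ++ y) (x' ++ y') u₂
  | vcomp {u y b u' v b' v' : List α} (h₁ : Grid R u y b u') (h₂ : Grid R v b b' v') :
      Grid R (u ++ v) y b' (u' ++ v')

variable {R : Rels α}

theorem Cell.symm {s t : α} {p q : List α} (h : Cell R s t p q) : Cell R t s q p := by
  rcases h with ⟨rfl, rfl, rfl⟩ | h
  · exact Or.inl ⟨rfl, rfl, rfl⟩
  · exact Or.inr (Sym2.eq_swap ▸ h)

theorem Cell.mono {R' : Rels α} (hR : R ⊆ R') {s t : α} {p q : List α} (h : Cell R s t p q) :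
    Cell R' s t p q := h.imp id fun h => hR h

namespace Grid

theorem symm {u v v' u' : List α} (h : Grid R u v v' u') : Grid R v u u' v' := by
  induction h with
  | nil_left v => exact nil_right v
  | nil_right u => exact nil_left u
  | cell h => exact cell h.symm
  | hcomp _ _ h₁ h₂ => exact vcomp h₁ h₂
  | vcomp _ _ h₁ h₂ => exact hcomp h₁ h₂

theorem mono {R' : Rels α} (hR : R ⊆ R') {u v v' u' : List α} (h : Grid R u v v' u') :
    Grid R' u v v' u' := by
  induction h with
  | nil_left v => exact nil_left v
  | nil_right u => exact nil_right u
  | cell h => exact cell (h.mono hR)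
  | hcomp _ _ h₁ h₂ => exact hcomp h₁ h₂
  | vcomp _ _ h₁ h₂ => exact vcomp h₁ h₂

theorem eq_of_nil {u v p q : List α} (h : Grid R u v p q) :
    (v = [] → p = [] ∧ q = u) ∧ (u = [] → p = v ∧ q = []) := by
  induction h with
  | nil_left v => simp
  | nil_right u => simp
  | cell h => simp
  | hcomp _ _ h₁ h₂ =>
    constructor
    · intro h
      obtain ⟨hx, hy⟩ := List.append_eq_nil_iff.1 h
      obtain ⟨rfl, rfl⟩ := h₁.1 hx
      obtain ⟨rfl, rfl⟩ := h₂.1 hy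
      simp
    · intro h
      obtain ⟨rfl, rfl⟩ := h₁.2 h
      obtain ⟨rfl, rfl⟩ := h₂.2 rfl
      simp
  | vcomp _ _ h₁ h₂ =>
    constructor
    · intro h
      obtain ⟨rfl, rfl⟩ := h₁.1 h
      obtain ⟨rfl, rfl⟩ := h₂.1 rfl
      simp
    · intro h
      obtain ⟨hx, hy⟩ := List.append_eq_nil_iff.1 h
      obtain ⟨rfl, rfl⟩ := h₁.2 hx
      obtain ⟨rfl, rfl⟩ := h₂.2 hy
      simp

@[simp] theorem nil_right_iff {u p q : List α} : Grid R u [] p q ↔ p = [] ∧ q = u :=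
  ⟨fun h => h.eq_of_nil.1 rfl, by rintro ⟨rfl, rfl⟩; exact nil_right _⟩

@[simp] theorem nil_left_iff {v p q : List α} : Grid R [] v p q ↔ p = v ∧ q = [] :=
  ⟨fun h => h.eq_of_nil.2 rfl, by rintro ⟨rfl, rfl⟩; exact nil_left _⟩

/-- Grids are rectangles, so they can be cut along any vertical or horizontal line. This inverts
`hcomp` and `vcomp` for arbitrary factorizations, not only those used to build the grid. -/
theorem split {u v p q : List α} (h : Grid R u v p q) :
    (∀ x y, v = x ++ y → ∃ x' u₁ y', Grid R u x x' u₁ ∧ Grid R u₁ y y' q ∧ p = x' ++ y') ∧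
    (∀ x y, u = x ++ y → ∃ b x' y', Grid R x v b x' ∧ Grid R y b p y' ∧ q = x' ++ y') := by
  induction h with
  | nil_left v =>
    refine ⟨fun x y h => ⟨x, [], y, nil_left _, nil_left _, h⟩, fun x y h => ?_⟩
    obtain ⟨rfl, rfl⟩ := List.append_eq_nil_iff.1 h.symm
    exact ⟨v, [], [], nil_left _, nil_left _, rfl⟩
  | nil_right u =>
    refine ⟨fun x y h => ?_, fun x y h => ⟨[], x, y, nil_right _, nil_right _, h⟩⟩
    obtain ⟨rfl, rfl⟩ := List.append_eq_nil_iff.1 h.symm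
    exact ⟨[], u, [], nil_right _, nil_right _, rfl⟩
  | @cell s t p q h =>
    constructor
    · intro x y hxy
      rcases List.singleton_eq_append_iff.1 hxy with ⟨rfl, rfl⟩ | ⟨rfl, rfl⟩
      · exact ⟨[], [s], p, nil_right _, cell h, rfl⟩
      · exact ⟨p, q, [], cell h, nil_right _, by simp⟩
    · intro x y hxy
      rcases List.singleton_eq_append_iff.1 hxy with ⟨rfl, rfl⟩ | ⟨rfl, rfl⟩
      · exact ⟨[t], [], q, nil_left _, cell h, rfl⟩
      · exact ⟨p, q, [], cell h, nil_left _, by simp⟩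
  | @hcomp u x x' u₁ y y' u₂ g₁ g₂ h₁ h₂ =>
    constructor
    · intro r s hrs
      rcases List.append_eq_append_iff.1 hrs with ⟨z, rfl, rfl⟩ | ⟨z, rfl, rfl⟩
      · obtain ⟨z', v, s', k₁, k₂, rfl⟩ := h₂.1 z s rfl
        exact ⟨_, _, _, hcomp g₁ k₁, k₂, by simp⟩
      · obtain ⟨r', v, z', k₁, k₂, rfl⟩ := h₁.1 r z rfl
        exact ⟨_, _, _, k₁, hcomp k₂ g₂, by simp⟩
    · intro r s hrs
      obtain ⟨b, r', s', k₁, k₂, rfl⟩ := h₁.2 r s hrs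
      obtain ⟨b₂, r₂, s₂, k₃, k₄, rfl⟩ := h₂.2 r' s' rfl
      exact ⟨_, _, _, hcomp k₁ k₃, hcomp k₂ k₄, rfl⟩
  | @vcomp u y b u' v b' v' g₁ g₂ h₁ h₂ =>
    constructor
    · intro r s hrs
      obtain ⟨r', u₁, s', k₁, k₂, rfl⟩ := h₁.1 r s hrs
      obtain ⟨r₂, u₂, s₂, k₃, k₄, rfl⟩ := h₂.1 r' s' rfl
      exact ⟨_, _, _, vcomp k₁ k₃, vcomp k₂ k₄, rfl⟩
    · intro r s hrs
      rcases List.append_eq_append_iff.1 hrs with ⟨z, rfl, rfl⟩ | ⟨z, rfl, rfl⟩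
      · obtain ⟨d, z', s', k₁, k₂, rfl⟩ := h₂.2 z s rfl
        exact ⟨_, _, _, vcomp g₁ k₁, k₂, by simp⟩
      · obtain ⟨d, r', z', k₁, k₂, rfl⟩ := h₁.2 r z rfl
        exact ⟨_, _, _, k₁, vcomp k₂ g₂, by simp⟩

theorem right_append_iff {u x y p q : List α} : Grid R u (x ++ y) p q ↔
    ∃ x' u₁ y', Grid R u x x' u₁ ∧ Grid R u₁ y y' q ∧ p = x' ++ y' :=
  ⟨fun h => h.split.1 x y rfl, by rintro ⟨_, _, _, h₁, h₂, rfl⟩; exact hcomp h₁ h₂⟩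

theorem left_append_iff {v x y p q : List α} : Grid R (x ++ y) v p q ↔
    ∃ b x' y', Grid R x v b x' ∧ Grid R y b p y' ∧ q = x' ++ y' :=
  ⟨fun h => h.split.2 x y rfl, by rintro ⟨_, _, _, h₁, h₂, rfl⟩; exact vcomp h₁ h₂⟩

theorem to_cell {u v p q : List α} (h : Grid R u v p q) :
    ∀ s t, u = [s] → v = [t] → Cell R s t p q := by
  induction h with
  | nil_left v => simp
  | nil_right u => simp
  | cell h =>
    intro s t hs ht
    simp only [List.cons.injEq, and_true] at hs ht
    subst hs ht
    exact h
  | hcomp g₁ g₂ h₁ h₂ =>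
    intro s t hs ht
    rcases List.singleton_eq_append_iff.1 ht.symm with ⟨rfl, rfl⟩ | ⟨rfl, rfl⟩
    · obtain ⟨rfl, rfl⟩ := nil_right_iff.1 g₁
      exact h₂ s t hs rfl
    · obtain ⟨rfl, rfl⟩ := nil_right_iff.1 g₂
      rw [List.append_nil]
      exact h₁ s t hs rfl
  | vcomp g₁ g₂ h₁ h₂ =>
    intro s t hs ht
    rcases List.singleton_eq_append_iff.1 hs.symm with ⟨rfl, rfl⟩ | ⟨rfl, rfl⟩
    · obtain ⟨rfl, rfl⟩ := nil_left_iff.1 g₁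
      exact h₂ s t rfl ht
    · obtain ⟨rfl, rfl⟩ := nil_left_iff.1 g₂
      rw [List.append_nil]
      exact h₁ s t rfl ht

@[simp] theorem singleton_iff {s t : α} {p q : List α} : Grid R [s] [t] p q ↔ Cell R s t p q :=
  ⟨fun h => h.to_cell s t rfl rfl, cell⟩

theorem singleton_cons_iff {s t : α} {v p' q' : List α} : Grid R [s] (t :: v) p' q' ↔
    ∃ p q v', Cell R s t p q ∧ Grid R q v v' q' ∧ p' = p ++ v' := by
  rw [← List.singleton_append (l := v), right_append_iff]
  simp

theorem cons_cons_iff {s t : α} {u v p' q' : List α} : Grid R (s :: u) (t :: v) p' q' ↔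
    ∃ p q v₁ q₁ p₁ u₁ v₂ u₂, Cell R s t p q ∧ Grid R q v v₁ q₁ ∧ Grid R u p p₁ u₁ ∧
      Grid R u₁ v₁ v₂ u₂ ∧ p' = p₁ ++ v₂ ∧ q' = q₁ ++ u₂ := by
  rw [← List.singleton_append, left_append_iff]
  constructor
  · rintro ⟨b, x', y', h₁, h₂, rfl⟩
    obtain ⟨p, q, v₁, hc, hq, rfl⟩ := singleton_cons_iff.1 h₁
    obtain ⟨p₁, u₁, v₂, h₃, h₄, rfl⟩ := right_append_iff.1 h₂
    exact ⟨p, q, v₁, x', p₁, u₁, v₂, y', hc, hq, h₃, h₄, rfl, rfl⟩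
  · rintro ⟨p, q, v₁, q₁, p₁, u₁, v₂, u₂, hc, hq, h₃, h₄, rfl, rfl⟩
    exact ⟨p ++ v₁, q₁, u₂, singleton_cons_iff.2 ⟨p, q, v₁, hc, hq, rfl⟩, hcomp h₃ h₄, rfl⟩

theorem cons_same {u v p q : List α} (s : α) (h : Grid R u v p q) :
    Grid R (s :: u) (s :: v) p q :=
  cons_cons_iff.2 ⟨[], [], v, [], [], u, p, q, Or.inl ⟨rfl, rfl, rfl⟩, nil_left _, nil_right _, h,
    rfl, rfl⟩

theorem append_same {u v p q : List α} (x : List α) (h : Grid R u v p q) :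
    Grid R (x ++ u) (x ++ v) p q := by
  induction x with
  | nil => exact h
  | cons s x ih => exact ih.cons_same s

theorem refl (R : Rels α) (u : List α) : Grid R u u [] [] := by
  simpa using append_same u (nil_left (R := R) [])

theorem of_mem {u v : List α} (hu : u ≠ []) (hv : v ≠ []) (h : s(u, v) ∈ R) :
    Grid R u v [] [] := by
  obtain ⟨s, u, rfl⟩ := List.exists_cons_of_ne_nil hu
  obtain ⟨t, v, rfl⟩ := List.exists_cons_of_ne_nil hv
  exact cons_cons_iff.2 ⟨u, v, [], [], [], [], [], [], Or.inr h, refl R v, refl R u,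
    nil_left _, rfl, rfl⟩

theorem cons_of_cell {s t : α} {u v p q : List α} (hc : Cell R s t p q)
    (x₁ x₂ : List α) (h₁ : Grid R q v x₁ []) (h₂ : Grid R u p [] x₂) (h : Grid R x₂ x₁ [] []) :
    Grid R (s :: u) (t :: v) [] [] :=
  cons_cons_iff.2 ⟨p, q, x₁, [], [], x₂, [], [], hc, h₁, h₂, h, rfl, rfl⟩

/-- A grid has finitely many cells, so it uses only finitely many relations. -/
theorem exists_of_iUnion {P : ℕ → Rels α} (hP : Monotone P) {u v p q : List α}
    (h : Grid (⋃ k, P k) u v p q) : ∃ k, Grid (P k) u v p q := by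
  induction h with
  | nil_left v => exact ⟨0, nil_left v⟩
  | nil_right u => exact ⟨0, nil_right u⟩
  | cell h =>
    rcases h with h | h
    · exact ⟨0, cell (Or.inl h)⟩
    · obtain ⟨k, hk⟩ := Set.mem_iUnion.1 h
      exact ⟨k, cell (Or.inr hk)⟩
  | hcomp _ _ h₁ h₂ =>
    obtain ⟨k, hk⟩ := h₁
    obtain ⟨l, hl⟩ := h₂
    exact ⟨max k l, hcomp (hk.mono (hP (le_max_left k l))) (hl.mono (hP (le_max_right k l)))⟩
  | vcomp _ _ h₁ h₂ =>
    obtain ⟨k, hk⟩ := h₁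
    obtain ⟨l, hl⟩ := h₂
    exact ⟨max k l, vcomp (hk.mono (hP (le_max_left k l))) (hl.mono (hP (le_max_right k l)))⟩

end Grid

/-! ### From reversing sequences of signed words to grids -/

@[simp] theorem pos_nil : pos ([] : List α) = [] := rfl
@[simp] theorem neg_nil : neg ([] : List α) = [] := rfl
@[simp] theorem pos_cons (s : α) (u : List α) : pos (s :: u) = (s, true) :: pos u := rfl
@[simp] theorem pos_append (u v : List α) : pos (u ++ v) = pos u ++ pos v := by simp [pos]
@[simp] theorem neg_append (u v : List α) : neg (u ++ v) = neg v ++ neg u := by simp [neg]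
theorem neg_cons (s : α) (u : List α) : neg (s :: u) = neg u ++ [(s, false)] := by simp [neg]

/-- `Outcome R w p q`: some reversing grid takes the signed word `w` to `p q⁻¹`. -/
inductive Outcome (R : Rels α) : SignedWord α → List α → List α → Prop
  | nil : Outcome R [] [] []
  | pos {w : SignedWord α} {p q : List α} (s : α) (h : Outcome R w p q) :
      Outcome R ((s, true) :: w) (s :: p) q
  | neg {w : SignedWord α} {p q p' r : List α} (s : α) (h : Outcome R w p q)
      (g : Grid R [s] p p' r) : Outcome R ((s, false) :: w) p' (q ++ r)

namespace Outcome

theorem pos_append_iff {u p q : List α} {w : SignedWord α} :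
    Outcome R (WordReversing.pos u ++ w) p q ↔ ∃ p₀, Outcome R w p₀ q ∧ p = u ++ p₀ := by
  induction u generalizing p with
  | nil => simp
  | cons s u ih =>
    constructor
    · intro h
      rcases h with _ | ⟨_, h⟩
      obtain ⟨p₀, h', rfl⟩ := ih.1 h
      exact ⟨p₀, h', rfl⟩
    · rintro ⟨p₀, h, rfl⟩
      exact .pos s (ih.2 ⟨p₀, h, rfl⟩)

theorem neg_append_iff {u p q : List α} {w : SignedWord α} :
    Outcome R (WordReversing.neg u ++ w) p q ↔
      ∃ p₀ q₀ r, Outcome R w p₀ q₀ ∧ Grid R u p₀ p r ∧ q = q₀ ++ r := by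
  induction u generalizing p q w with
  | nil => simp
  | cons s u ih =>
    rw [neg_cons, List.append_assoc, List.singleton_append, ih]
    constructor
    · rintro ⟨p₁, q₁, r, h, g, rfl⟩
      rcases h with _ | _ | ⟨_, h, g'⟩
      exact ⟨_, _, _, h, Grid.vcomp g' g, by simp⟩
    · rintro ⟨p₀, q₀, r, h, g, rfl⟩
      rw [← List.singleton_append] at g
      obtain ⟨b, x', y', h₁, h₂, rfl⟩ := Grid.left_append_iff.1 g
      exact ⟨_, _, _, .neg s h h₁, h₂, by simp⟩

theorem append_left {w w' : SignedWord α} (H : ∀ p q, Outcome R w' p q → Outcome R w p q)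
    (x : SignedWord α) : ∀ p q, Outcome R (x ++ w') p q → Outcome R (x ++ w) p q := by
  induction x with
  | nil => exact H
  | cons s x ih =>
    intro p q h
    rcases h with _ | ⟨_, h⟩ | ⟨_, h, g⟩
    · exact .pos _ (ih _ _ h)
    · exact .neg _ (ih _ _ h) g

/-- The rectangle of the reversing step can be glued into the grid of `w'`. Pulling outcomes back in
this way along a reversing sequence, starting from its terminal word `p q⁻¹`, makes the order of the
steps irrelevant. -/
theorem of_revStep {w w' : SignedWord α} (h : RevStep R w w') :
    ∀ p q, Outcome R w' p q → Outcome R w p q := by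
  cases h with
  | delete x y u hu =>
    rw [List.append_assoc, List.append_assoc]
    refine append_left (fun p q h => ?_) x
    rw [neg_append_iff]
    refine ⟨u ++ p, q, [], pos_append_iff.2 ⟨p, h, rfl⟩, ?_, by simp⟩
    simpa using Grid.append_same u (Grid.nil_left (R := R) p)
  | replace x y u v u' v' hu hv hR =>
    simp only [List.append_assoc]
    refine append_left (fun p q h => ?_) x
    obtain ⟨p₁, h₁, rfl⟩ := pos_append_iff.1 h
    obtain ⟨p₀, q₀, r, h₀, g, rfl⟩ := neg_append_iff.1 h₁
    refine neg_append_iff.2 ⟨v ++ p₀, q₀, r, pos_append_iff.2 ⟨p₀, h₀, rfl⟩, ?_, rfl⟩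
    obtain ⟨s, u, rfl⟩ := List.exists_cons_of_ne_nil hu
    obtain ⟨t, v, rfl⟩ := List.exists_cons_of_ne_nil hv
    -- A step on long subwords starts with the cell of their first letters; the rest of `u` and of
    -- `v` is then cancelled against equal prefixes.
    refine Grid.cons_cons_iff.2 ⟨u ++ v', v ++ u', p₁, r, v', [], p₁, [], Or.inr hR,
      g.append_same v, ?_, Grid.nil_left _, rfl, by simp⟩
    simpa using Grid.append_same u (Grid.nil_left (R := R) v')

theorem pos_neg (u v : List α) : Outcome R (WordReversing.pos u ++ WordReversing.neg v) u v := by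
  refine pos_append_iff.2 ⟨[], ?_, by simp⟩
  rw [← List.append_nil (WordReversing.neg v)]
  exact neg_append_iff.2 ⟨[], [], v, .nil, Grid.nil_right v, rfl⟩

end Outcome

theorem Reverses.outcome {w : SignedWord α} {p q : List α} (h : Reverses R w (pos p ++ neg q)) :
    Outcome R w p q := by
  induction h using Relation.ReflTransGen.head_induction_on with
  | refl => exact Outcome.pos_neg p q
  | head h _ ih => exact Outcome.of_revStep h _ _ ih

theorem Reverses.refl (w : SignedWord α) : Reverses R w w := Relation.ReflTransGen.refl

theorem Reverses.append {w w' : SignedWord α} (h : Reverses R w w') (x y : SignedWord α) :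
    Reverses R (x ++ w ++ y) (x ++ w' ++ y) := by
  induction h with
  | refl => exact .refl _
  | tail _ h ih =>
    refine ih.tail ?_
    cases h with
    | delete x' y' u hu => simpa using RevStep.delete (R := R) (x ++ x') (y' ++ y) u hu
    | replace x' y' u v u' v' hu hv hR =>
      simpa using RevStep.replace (R := R) (x ++ x') (y' ++ y) u v u' v' hu hv hR

theorem Grid.reverses {u v p q : List α} (h : Grid R u v p q) :
    Reverses R (neg u ++ pos v) (pos p ++ neg q) := by
  induction h with
  | nil_left v => simpa using Reverses.refl _
  | nil_right u => simpa using Reverses.refl _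
  | @cell s t p q h =>
    rcases h with ⟨rfl, rfl, rfl⟩ | h
    · exact .single (by simpa using RevStep.delete (R := R) [] [] [s] (by simp))
    · exact .single (by
        simpa using RevStep.replace (R := R) [] [] [s] [t] q p (by simp) (by simp) h)
  | @hcomp u x x' u₁ y y' u₂ _ _ h₁ h₂ =>
    have h₃ := h₁.append [] (pos y)
    have h₄ := h₂.append (pos x') []
    simp only [List.nil_append, List.append_nil, List.append_assoc, pos_append] at h₃ h₄ ⊢
    exact h₃.trans h₄
  | @vcomp u y b u' v b' v' _ _ h₁ h₂ =>
    have h₃ := h₁.append (neg v) []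
    have h₄ := h₂.append [] (neg u')
    simp only [List.nil_append, List.append_nil, List.append_assoc, neg_append] at h₃ h₄ ⊢
    exact h₃.trans h₄

theorem reverses_nil_iff {u v : List α} :
    Reverses R (neg u ++ pos v) [] ↔ Grid R u v [] [] := by
  constructor
  · intro h
    obtain ⟨p₀, q₀, r, h, g, hq⟩ := Outcome.neg_append_iff.1 (Reverses.outcome (p := []) (q := []) h)
    rw [← List.append_nil (pos v)] at h
    obtain ⟨p, h', rfl⟩ := Outcome.pos_append_iff.1 h
    cases h'
    obtain rfl : [] = r := by simpa using hq
    simpa using g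
  · intro h
    simpa using h.reverses

theorem passesTest_iff {s t : α} {u v : List α} :
    PassesTest R s t u v ↔ Grid R (s :: u) (t :: v) [] [] := reverses_nil_iff

/-- Reversing `s⁻¹r` and `r⁻¹t` takes one cell each, and what remains is a grid between the two
inner sides. -/
theorem isTest_iff {s r t : α} {u v : List α} : IsTest R s r t u v ↔
    ∃ p₁ q₁ p q p' q', Cell R r t p₁ q₁ ∧ Cell R s r p q ∧ Grid R q p₁ p' q' ∧
      u = p ++ p' ∧ v = q₁ ++ q' := by
  constructor
  · intro h
    have h₀ := Reverses.outcome h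
    rw [List.append_assoc, List.append_assoc] at h₀
    obtain ⟨p₀, q₀, x, h₁, g, rfl⟩ := Outcome.neg_append_iff.1 h₀
    obtain ⟨p₂, h₂, rfl⟩ := Outcome.pos_append_iff.1 h₁
    obtain ⟨p₃, q₃, x₃, h₃, g', rfl⟩ := Outcome.neg_append_iff.1 h₂
    rw [← List.append_nil (pos [t])] at h₃
    obtain ⟨p₄, h₄, rfl⟩ := Outcome.pos_append_iff.1 h₃
    cases h₄
    obtain ⟨p, q, v', hc, k, rfl⟩ := Grid.singleton_cons_iff.1 g
    exact ⟨p₂, x₃, p, q, v', x, by simpa using g', hc, k, rfl, rfl⟩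
  · rintro ⟨p₁, q₁, p, q, p', q', h₁, h₂, g, rfl, rfl⟩
    have k₁ := (Grid.cell h₁).reverses.append (neg [s] ++ pos [r]) []
    have k₂ := (Grid.singleton_cons_iff.2 ⟨p, q, p', h₂, g, rfl⟩).reverses.append [] (neg q₁)
    simp only [List.nil_append, List.append_nil, List.append_assoc, pos_append,
      pos_cons, pos_nil, List.cons_append] at k₁ k₂
    simp only [IsTest, List.append_assoc, pos_cons, pos_nil, neg_append, pos_append,
      List.cons_append, List.nil_append]
    exact k₁.trans k₂

/-! ### Reversing only proves valid equalities -/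

theorem Equivalent.refl (R : Rels α) (u : List α) : Equivalent R u u := (conGen _).refl _

theorem Equivalent.symm {u v : List α} (h : Equivalent R u v) : Equivalent R v u :=
  (conGen _).symm h

theorem Equivalent.trans {u v w : List α} (h : Equivalent R u v) (h' : Equivalent R v w) :
    Equivalent R u w := (conGen _).trans h h'

theorem Equivalent.append {u v u' v' : List α} (h : Equivalent R u v) (h' : Equivalent R u' v') :
    Equivalent R (u ++ u') (v ++ v') := (conGen _).mul h h'

theorem Equivalent.of_mem {u v : List α} (h : s(u, v) ∈ R) : Equivalent R u v :=
  ConGen.Rel.of _ _ h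

theorem Cell.equivalent {s t : α} {p q : List α} (h : Cell R s t p q) :
    Equivalent R (s :: p) (t :: q) := by
  rcases h with ⟨rfl, rfl, rfl⟩ | h
  · exact .refl R _
  · exact .of_mem h

theorem Grid.equivalent {u v p q : List α} (h : Grid R u v p q) :
    Equivalent R (u ++ p) (v ++ q) := by
  induction h with
  | nil_left v => simpa using Equivalent.refl R v
  | nil_right u => simpa using Equivalent.refl R u
  | cell h => exact h.equivalent
  | @hcomp u x x' u₁ y y' u₂ _ _ h₁ h₂ =>
    have k₁ := h₁.append (.refl R y')
    have k₂ := (Equivalent.refl R x).append h₂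
    simp only [List.append_assoc] at k₁ k₂ ⊢
    exact k₁.trans k₂
  | @vcomp u y b u' v b' v' _ _ h₁ h₂ =>
    have k₁ := h₁.append (.refl R v')
    have k₂ := (Equivalent.refl R u).append h₂
    simp only [List.append_assoc] at k₁ k₂ ⊢
    exact k₂.trans k₁

theorem IsTest.equivalent {s r t : α} {u v : List α} (h : IsTest R s r t u v) :
    Equivalent R (s :: u) (t :: v) := by
  obtain ⟨p₁, q₁, p, q, p', q', h₁, h₂, g, rfl, rfl⟩ := isTest_iff.1 h
  have k₁ := h₁.equivalent.append (.refl R q')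
  have k₂ := h₂.equivalent.append (.refl R p')
  have k₃ := (Equivalent.refl R [r]).append g.equivalent
  simp only [List.cons_append, List.nil_append] at k₁ k₂ k₃
  exact k₂.trans (k₃.trans k₁)

end Grid

open Gen

instance : DecidableEq Gen := fun x y => by
  cases x <;> cases y <;> first | exact isTrue rfl | exact isFalse (by simp)

/-! ### The action on normal forms -/

/-- Normal forms `bᵏ w dᵉ`, with `w` a word in `a` and `c`, and with `e` possibly negative. -/
@[ext] structure State where
  k : ℕ
  w : List Gen
  e : ℤ

/-- The triangular numbers `0 + 1 + ⋯ + (k - 1)`. -/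
def tri : ℕ → ℕ
  | 0 => 0
  | k + 1 => tri k + k

/-- Left multiplication of a normal form by a generator, as dictated by `ab = bac`, `cb = bcd⁻¹`
and the centrality of `d`. -/
def act : Gen → State → State
  | a, s => ⟨s.k, a :: (List.replicate s.k c ++ s.w), s.e - tri s.k⟩
  | b, s => ⟨s.k + 1, s.w, s.e⟩
  | c, s => ⟨s.k, c :: s.w, s.e - s.k⟩
  | d, s => ⟨s.k, s.w, s.e + 1⟩

/-- Left multiplication of a normal form by a word. -/
def actWord (u : List Gen) (s : State) : State := u.foldr act s

/-- The normal form of a word. -/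
def normalForm (u : List Gen) : State := actWord u ⟨0, [], 0⟩

@[simp] theorem actWord_nil (s : State) : actWord [] s = s := rfl

@[simp] theorem actWord_cons (x : Gen) (u : List Gen) (s : State) :
    actWord (x :: u) s = act x (actWord u s) := rfl

@[simp] theorem actWord_append (u v : List Gen) (s : State) :
    actWord (u ++ v) s = actWord u (actWord v s) := List.foldr_append

theorem normalForm_cons (x : Gen) (u : List Gen) :
    normalForm (x :: u) = act x (normalForm u) := rfl

theorem normalForm_append (u v : List Gen) : normalForm (u ++ v) = actWord u (normalForm v) :=
  actWord_append u v _

theorem act_injective (x : Gen) : Function.Injective (act x) := by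
  rintro ⟨k, w, e⟩ ⟨k', w', e'⟩ h
  cases x <;> simp only [act, State.mk.injEq] at h ⊢
  · obtain ⟨rfl, h, h'⟩ := h
    simp at h h'
    exact ⟨rfl, h, h'⟩
  · simpa using h
  · obtain ⟨rfl, h, h'⟩ := h
    simp at h h'
    exact ⟨rfl, h, h'⟩
  · simpa using h

/-- The word `(acᵏ)ⁿ`. -/
def block (k n : ℕ) : List Gen := (List.replicate n (a :: List.replicate k c)).flatten

@[simp] theorem block_zero (k : ℕ) : block k 0 = [] := rfl

@[simp] theorem block_succ (k n : ℕ) :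
    block k (n + 1) = a :: (List.replicate k c ++ block k n) := by
  simp [block, List.replicate_succ]

@[simp] theorem count_block (k n : ℕ) : (block k n).count a = n := by
  induction n with
  | zero => rfl
  | succ n ih => simp [ih, List.count_replicate]

theorem replicate_c_append (k : ℕ) (w : List Gen) :
    List.replicate k c ++ c :: w = c :: (List.replicate k c ++ w) := by
  rw [← List.cons_append, ← List.replicate_succ, List.replicate_succ']
  simp

theorem addedRel_eq (n : ℕ) :
    addedRel n = s(b :: (block 1 n ++ [c]), d :: (List.replicate n a ++ [c, b])) := by
  simp [addedRel, block]

/-- Crossing `bᵏ`, the letter `c` costs `k` copies of `d⁻¹` and `a` costs `tri k`, so each `ac`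
costs `tri (k + 1)`. -/
theorem actWord_block_one (n k : ℕ) (w : List Gen) (e : ℤ) :
    actWord (block 1 n) ⟨k, w, e⟩ = ⟨k, block (k + 1) n ++ w, e - n * tri (k + 1)⟩ := by
  induction n with
  | zero => simp
  | succ n ih =>
    simp [ih, act, tri, List.replicate_succ, replicate_c_append]
    ring

theorem actWord_replicate_a (n k : ℕ) (w : List Gen) (e : ℤ) :
    actWord (List.replicate n a) ⟨k, w, e⟩ = ⟨k, block k n ++ w, e - n * tri k⟩ := by
  induction n with
  | zero => simp
  | succ n ih =>
    simp [ih, act, List.replicate_succ]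
    ring

/-- Two words act in the same way on normal forms whenever they are equivalent. -/
theorem Equivalent.actWord_eq {R : Rels Gen}
    (hR : ∀ u v : List Gen, s(u, v) ∈ R → actWord u = actWord v) {u v : List Gen}
    (h : Equivalent R u v) : actWord u = actWord v := by
  let f : FreeMonoid Gen →* Function.End State := FreeMonoid.lift act
  have hf : ∀ u : List Gen, f (FreeMonoid.ofList u) = actWord u := by
    intro u
    induction u with
    | nil => exact map_one f
    | cons x u ih =>
      have : FreeMonoid.ofList (x :: u) = FreeMonoid.of x * FreeMonoid.ofList u := rfl
      rw [this, map_mul, ih]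
      rfl
  have hle : conGen (toRel R) ≤ Con.ker f := Con.conGen_le.2 fun x y hxy => by
    have := hR _ _ hxy
    rw [← hf, ← hf] at this
    exact this
  have := hle h
  rw [Con.ker_apply, hf, hf] at this
  exact this

/-! ### The intermediate presentations -/

/-- The base relations, together with the added relations whose index lies in `I`. -/
def relsUpTo (I : Set ℕ) : Rels Gen := baseRels ∪ addedRel '' I

theorem relsUpTo_mono {I J : Set ℕ} (h : I ⊆ J) : relsUpTo I ⊆ relsUpTo J :=
  Set.union_subset_union_right _ (Set.image_mono h)

theorem base_subset (I : Set ℕ) : baseRels ⊆ relsUpTo I := Set.subset_union_left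

theorem actWord_eq_of_mem {I : Set ℕ} (u v : List Gen) (h : s(u, v) ∈ relsUpTo I) :
    actWord u = actWord v := by
  rcases h with h | ⟨n, -, h⟩
  · simp only [baseRels, Set.mem_insert_iff, Set.mem_singleton_iff, Sym2.eq_iff] at h
    rcases h with (⟨rfl, rfl⟩ | ⟨rfl, rfl⟩) | (⟨rfl, rfl⟩ | ⟨rfl, rfl⟩) |
        (⟨rfl, rfl⟩ | ⟨rfl, rfl⟩) | (⟨rfl, rfl⟩ | ⟨rfl, rfl⟩) | (⟨rfl, rfl⟩ | ⟨rfl, rfl⟩) <;>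
      funext s <;>
      simp [act, tri, List.replicate_succ, replicate_c_append] <;> ring
  · have key : actWord (b :: (block 1 n ++ [c])) = actWord (d :: (List.replicate n a ++ [c, b])) := by
      funext s
      simp [act, actWord_block_one, actWord_replicate_a]
      ring
    rw [addedRel_eq, Sym2.eq_iff] at h
    rcases h with ⟨rfl, rfl⟩ | ⟨rfl, rfl⟩
    · exact key
    · exact key.symm

theorem Equivalent.normalForm_eq {I : Set ℕ} {u v : List Gen}
    (h : Equivalent (relsUpTo I) u v) : normalForm u = normalForm v :=
  congrFun (h.actWord_eq actWord_eq_of_mem) _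

/-! ### Which states are normal forms of words -/

/-- The longest word whose image under `a ↦ ac, c ↦ c` is a prefix of the given word. -/
def decode : List Gen → List Gen
  | c :: w => c :: decode w
  | a :: c :: w => a :: decode w
  | _ => []

/-- The substitution `a ↦ ac, c ↦ c`, deleting the other letters. -/
def encode : List Gen → List Gen
  | [] => []
  | a :: w => a :: c :: encode w
  | c :: w => c :: encode w
  | _ :: w => encode w

/-- The largest possible number of `d⁻¹` in the normal form of a word with `k` letters `b` and with
`w` as its part in `a` and `c`. -/
def depth : ℕ → List Gen → ℕ
  | 0, _ => 0
  | k + 1, w => (decode w).count c + depth k (decode w)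

/-- The words in the letters `a` and `c`. -/
def IsAC (w : List Gen) : Prop := ∀ x ∈ w, x = a ∨ x = c

theorem isAC_append {u v : List Gen} : IsAC (u ++ v) ↔ IsAC u ∧ IsAC v := by
  simp [IsAC, or_imp, forall_and]

theorem isAC_cons {x : Gen} {w : List Gen} : IsAC (x :: w) ↔ (x = a ∨ x = c) ∧ IsAC w := by
  simp [IsAC]

theorem isAC_replicate_c (k : ℕ) : IsAC (List.replicate k c) := by
  intro x hx
  exact Or.inr (List.eq_of_mem_replicate hx)

theorem isAC_decode : ∀ w : List Gen, IsAC (decode w)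
  | [] => by simp [decode, IsAC]
  | c :: w => by simpa [decode, isAC_cons] using isAC_decode w
  | a :: c :: w => by simpa [decode, isAC_cons] using isAC_decode w
  | [a] => by simp [decode, IsAC]
  | a :: a :: w => by simp [decode, IsAC]
  | a :: b :: w => by simp [decode, IsAC]
  | a :: d :: w => by simp [decode, IsAC]
  | b :: w => by simp [decode, IsAC]
  | d :: w => by simp [decode, IsAC]

theorem exists_encode_decode_append : ∀ w : List Gen, ∃ y, w = encode (decode w) ++ y
  | [] => by simp [decode, encode]
  | c :: w => by simpa [decode, encode] using exists_encode_decode_append w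
  | a :: c :: w => by simpa [decode, encode] using exists_encode_decode_append w
  | [a] => by simp [decode, encode]
  | a :: a :: w => by simp [decode, encode]
  | a :: b :: w => by simp [decode, encode]
  | a :: d :: w => by simp [decode, encode]
  | b :: w => by simp [decode, encode]
  | d :: w => by simp [decode, encode]

@[simp] theorem encode_append (u v : List Gen) : encode (u ++ v) = encode u ++ encode v := by
  induction u with
  | nil => rfl
  | cons x u ih => cases x <;> simp [encode, ih]

@[simp] theorem encode_replicate_c (k : ℕ) :
    encode (List.replicate k c) = List.replicate k c := by
  induction k with
  | zero => rfl
  | succ k ih => simp [List.replicate_succ, encode, ih]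

theorem encode_block (k n : ℕ) : encode (block k n) = block (k + 1) n := by
  induction n with
  | zero => rfl
  | succ n ih => simp [encode, ih, List.replicate_succ]

theorem decode_encode : ∀ {w : List Gen}, IsAC w → decode (encode w) = w
  | [], _ => rfl
  | a :: w, h => by simpa [encode, decode] using decode_encode (isAC_cons.1 h).2
  | c :: w, h => by simpa [encode, decode] using decode_encode (isAC_cons.1 h).2
  | b :: w, h => by simp [isAC_cons] at h
  | d :: w, h => by simp [isAC_cons] at h

theorem decode_replicate_c_append (k : ℕ) (w : List Gen) :
    decode (List.replicate k c ++ w) = List.replicate k c ++ decode w := by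
  induction k with
  | zero => rfl
  | succ k ih => simp [List.replicate_succ, decode, ih]

theorem depth_c (k : ℕ) (w : List Gen) : depth k (c :: w) = k + depth k w := by
  induction k generalizing w with
  | zero => rfl
  | succ k ih =>
    simp [depth, decode, ih]
    ring

/-- Each decoding removes one `c` after the leading `a`, so the successive contributions are `k + m
- 1, …, m`. -/
theorem depth_a (k m : ℕ) (w : List Gen) :
    depth k (a :: (List.replicate (k + m) c ++ w)) = tri k + k * m + depth k w := by
  induction k generalizing w with
  | zero => simp [depth, tri]
  | succ k ih =>
    rw [show k + 1 + m = (k + m) + 1 by ring, List.replicate_succ]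
    simp [depth, decode, ih, decode_replicate_c_append, tri]
    ring

theorem depth_block (k n : ℕ) (w : List Gen) :
    depth k (block (k + 1) n ++ w) = n * tri (k + 1) + depth k w := by
  induction n with
  | zero => simp
  | succ n ih =>
    simp [depth_a, ih, tri]
    ring

theorem depth_le_succ (k : ℕ) (w : List Gen) : depth k w ≤ depth (k + 1) w := by
  induction k generalizing w with
  | zero => simp [depth]
  | succ k ih =>
    have := ih (decode w)
    simp only [depth] at this ⊢
    omega

theorem exists_block_of_count {w : List Gen} (hw : IsAC w) (h : 0 < w.count c) :
    ∃ n y, w = block 0 n ++ c :: y := by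
  induction w with
  | nil => simp at h
  | cons x w ih =>
    rcases (isAC_cons.1 hw).1 with rfl | rfl
    · obtain ⟨n, y, rfl⟩ := ih (isAC_cons.1 hw).2 (by simpa using h)
      exact ⟨n + 1, y, by simp⟩
    · exact ⟨0, w, by simp⟩

/-- The sum defining `depth` telescopes: the difference counts the letters `c` in the `(k + 1)`-fold
decoding of `w`. If there is one, that decoding begins with `aⁿc`, and encoding `k + 1` times gives
the prefix. -/
theorem exists_block_of_depth_lt {k : ℕ} {w : List Gen} (h : depth k w < depth (k + 1) w) :
    ∃ n y, w = block (k + 1) n ++ c :: y := by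
  obtain ⟨z, hz⟩ := exists_encode_decode_append w
  have : ∃ n y, decode w = block k n ++ c :: y := by
    induction k generalizing w z with
    | zero => exact exists_block_of_count (isAC_decode w) (by simpa [depth] using h)
    | succ k ih =>
      obtain ⟨z', hz'⟩ := exists_encode_decode_append (decode w)
      have h' : depth k (decode w) < depth (k + 1) (decode w) := by
        simp only [depth] at h ⊢
        omega
      obtain ⟨n, y, hy⟩ := ih h' z' hz'
      rw [hy] at hz'
      exact ⟨n, encode y ++ z', by simpa [encode, encode_block] using hz'⟩
  obtain ⟨n, y, hy⟩ := this
  rw [hy] at hz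
  exact ⟨n, encode y ++ z, by simpa [encode, encode_block] using hz⟩

/-- The normal forms of words: the part in `a` and `c` and the exponent of `d` are constrained. -/
structure State.Valid (s : State) : Prop where
  isAC : IsAC s.w
  nonneg : 0 ≤ s.e + depth s.k s.w

/-- Multiplying by `a` or `c` raises `depth` by exactly the amount by which the exponent of `d`
drops; `b` and `d` do not decrease the sum. -/
theorem valid_normalForm (u : List Gen) : (normalForm u).Valid := by
  induction u with
  | nil => exact ⟨by simp [normalForm, IsAC], by simp [normalForm]⟩
  | cons x u ih =>
    obtain ⟨h₁, h₂⟩ := ih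
    rw [normalForm_cons]
    cases x
    · refine ⟨?_, ?_⟩
      · simpa [act, isAC_cons, isAC_append] using ⟨isAC_replicate_c _, h₁⟩
      · have := depth_a (normalForm u).k 0 (normalForm u).w
        simp only [act, add_zero] at this ⊢
        rw [this]
        push_cast
        linarith
    · refine ⟨h₁, ?_⟩
      have := depth_le_succ (normalForm u).k (normalForm u).w
      simp only [act]
      omega
    · refine ⟨by simpa [act, isAC_cons] using h₁, ?_⟩
      simp only [act, depth_c]
      push_cast
      linarith
    · refine ⟨h₁, ?_⟩
      simp only [act]
      linarith

/-- Together with `actWord_one`, this computes right multiplication by a generator from the normal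
form of the left factor alone. -/
theorem actWord_zero (u y : List Gen) (m : ℤ) : actWord u ⟨0, y, m⟩ =
    ⟨(normalForm u).k, (normalForm u).w ++ y, (normalForm u).e + m⟩ := by
  induction u with
  | nil => simp [normalForm]
  | cons x u ih =>
    cases x <;> simp [ih, normalForm_cons, act] <;> ring

theorem actWord_one (u y : List Gen) : actWord u ⟨1, y, 0⟩ =
    ⟨(normalForm u).k + 1, encode (normalForm u).w ++ y,
      (normalForm u).e - (normalForm u).w.count c⟩ := by
  induction u with
  | nil => simp [normalForm, encode]
  | cons x u ih =>
    cases x <;> simp [ih, normalForm_cons, act, encode, List.replicate_succ, tri] <;> ring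

theorem actWord_isAC {u : List Gen} (hu : IsAC u) (y : List Gen) (m : ℤ) :
    actWord u ⟨0, y, m⟩ = ⟨0, u ++ y, m⟩ := by
  induction u with
  | nil => rfl
  | cons x u ih =>
    rcases (isAC_cons.1 hu).1 with rfl | rfl <;> simp [ih (isAC_cons.1 hu).2, act, tri]

theorem actWord_replicate_d (n : ℕ) (s : State) :
    actWord (List.replicate n d) s = ⟨s.k, s.w, s.e + n⟩ := by
  induction n with
  | zero => simp
  | succ n ih =>
    simp [List.replicate_succ, ih, act]
    ring

/-- The bound `depth` is attained by putting the last `b` as far right as possible, just after a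
word whose part in `a, c` is `decode w`. -/
theorem exists_normalForm_eq {k : ℕ} {w : List Gen} {e : ℤ} (hw : IsAC w)
    (he : 0 ≤ e + depth k w) : ∃ u, normalForm u = ⟨k, w, e⟩ := by
  induction k generalizing w e with
  | zero =>
    obtain ⟨n, rfl⟩ := Int.eq_ofNat_of_zero_le (by simpa [depth] using he)
    refine ⟨w ++ List.replicate n d, ?_⟩
    rw [normalForm_append, normalForm, actWord_replicate_d, actWord_isAC hw]
    simp
  | succ k ih =>
    obtain ⟨y, hy⟩ := exists_encode_decode_append w
    -- The exponent is raised in advance, since moving the last `b` across `decode w` will cost one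
    -- `d⁻¹` for each `c`.
    obtain ⟨x, hx⟩ := ih (e := e + (decode w).count c) (isAC_decode w) (by
      simp only [depth] at he
      push_cast at he
      linarith)
    refine ⟨x ++ b :: y, ?_⟩
    have hyAC : IsAC y := by
      rw [hy, isAC_append] at hw
      exact hw.2
    rw [normalForm_append, normalForm_cons, normalForm, actWord_isAC hyAC]
    simp only [act, List.append_nil, zero_add]
    rw [actWord_one, hx]
    simp [← hy]

/-! ### Right cancellation and invariants -/

theorem encode_injOn {u v : List Gen} (hu : IsAC u) (hv : IsAC v) (h : encode u = encode v) :
    u = v := by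
  rw [← decode_encode hu, h, decode_encode hv]

theorem normalForm_right_cancel {u v : List Gen} (x : Gen)
    (h : normalForm (u ++ [x]) = normalForm (v ++ [x])) : normalForm u = normalForm v := by
  have hx : normalForm [x] = act x ⟨0, [], 0⟩ := rfl
  simp only [normalForm_append, hx] at h
  have hu := (valid_normalForm u).isAC
  have hv := (valid_normalForm v).isAC
  cases x <;>
    simp only [act, actWord_zero, actWord_one, State.mk.injEq, tri, Nat.cast_zero, zero_add,
      sub_zero, add_left_inj, List.append_nil, List.append_cancel_right_eq, List.replicate_zero] at h <;>
    obtain ⟨h₁, h₂, h₃⟩ := h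
  · exact State.ext h₁ h₂ h₃
  · have h₂ := encode_injOn hu hv h₂
    rw [h₂, sub_left_inj] at h₃
    exact State.ext h₁ h₂ h₃
  · exact State.ext h₁ h₂ h₃
  · exact State.ext h₁ h₂ h₃

theorem count_a_normalForm (u : List Gen) : (normalForm u).w.count a = u.count a := by
  induction u with
  | nil => rfl
  | cons x u ih => cases x <;> simp [normalForm_cons, act, ih, List.count_replicate]

/-- A pseudolength, read on normal forms. -/
def State.weight (s : State) : ℕ := (s.e + depth s.k s.w).toNat + s.k + s.w.length

/-- The pseudolength of a word. -/
def weight (u : List Gen) : ℕ := (normalForm u).weight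

/-- Adding `depth` to the exponent makes that term nonnegative and nondecreasing under the action;
`b` increases `k`, `a` and `c` lengthen `w`, and `d` increases `e`. -/
theorem weight_lt_cons (x : Gen) (u : List Gen) : weight u < weight (x :: u) := by
  have hv := (valid_normalForm u).nonneg
  simp only [weight, State.weight, normalForm_cons]
  set s := normalForm u
  have h₁ := depth_le_succ s.k s.w
  have h₂ := depth_a s.k 0 s.w
  have h₃ := depth_c s.k s.w
  rw [add_zero] at h₂
  cases x <;> simp only [act, List.length_cons, List.length_append, List.length_replicate] <;> omega

theorem homogeneous_relsUpTo (I : Set ℕ) : Homogeneous (relsUpTo I) :=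
  ⟨weight, weight_lt_cons, fun _ _ h => congrArg State.weight h.normalForm_eq⟩

theorem relsUpTo_empty : relsUpTo ∅ = baseRels := by simp [relsUpTo]

/-! ### Common right multiples of two generators -/

section Cells

variable (I : Set ℕ)

theorem cell_a_b : Cell (relsUpTo I) a b [b] [a, c] := .inr (.inl (by simp [baseRels]))
theorem cell_b_c : Cell (relsUpTo I) b c [c] [b, d] := .inr (.inl (by simp [baseRels]))
theorem cell_a_d : Cell (relsUpTo I) a d [d] [a] := .inr (.inl (by simp [baseRels]))
theorem cell_b_d : Cell (relsUpTo I) b d [d] [b] := .inr (.inl (by simp [baseRels]))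
theorem cell_c_d : Cell (relsUpTo I) c d [d] [c] := .inr (.inl (by simp [baseRels]))
theorem cell_added {I : Set ℕ} {n : ℕ} (hn : n ∈ I) :
    Cell (relsUpTo I) b d (block 1 n ++ [c]) (List.replicate n a ++ [c, b]) :=
  .inr (.inr ⟨n, hn, addedRel_eq n⟩)

end Cells

/-- Common right multiples in the presented monoid, in terms of normal forms. -/
def LcmStep (I : Set ℕ) (s t : Gen) (u v : List Gen) : Prop :=
  ∃ p q x, Cell (relsUpTo I) s t p q ∧ normalForm u = normalForm (p ++ x) ∧
    normalForm v = normalForm (q ++ x)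

theorem LcmStep.symm {I : Set ℕ} {s t : Gen} {u v : List Gen} (h : LcmStep I s t u v) :
    LcmStep I t s v u := by
  obtain ⟨p, q, x, hc, hu, hv⟩ := h
  exact ⟨q, p, x, hc.symm, hv, hu⟩

/-- By left cancellation, the factorization of `v` follows from that of `u`. -/
theorem lcmStep_of_left {I : Set ℕ} {s t : Gen} {u v p q x : List Gen}
    (h : normalForm (s :: u) = normalForm (t :: v)) (hc : Cell (relsUpTo I) s t p q)
    (hu : normalForm u = normalForm (p ++ x)) : LcmStep I s t u v := by
  refine ⟨p, q, x, hc, hu, act_injective t ?_⟩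
  have := (hc.equivalent.append (Equivalent.refl _ x)).normalForm_eq
  rw [normalForm_cons, normalForm_cons, hu] at h
  rw [← h]
  exact this

/-- As in the next three lemmas, the state of the quotient `x` is forced, and the validity bounds
already known for `u` and `v` show that a positive word realizes it. -/
theorem lcmStep_a_b (I : Set ℕ) {u v : List Gen} (h : normalForm (a :: u) = normalForm (b :: v)) :
    LcmStep I a b u v := by
  have hu := valid_normalForm u
  have hv := valid_normalForm v
  have h' := h
  simp only [normalForm_cons, act, State.mk.injEq] at h'
  obtain ⟨h₁, h₂, h₃⟩ := h'
  obtain ⟨x, hx⟩ : ∃ x, normalForm x = ⟨(normalForm v).k, (normalForm u).w, (normalForm u).e⟩ := by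
    refine exists_normalForm_eq hu.isAC ?_
    have := hv.nonneg
    rw [← h₂, ← h₃, h₁, depth_a] at this
    simp only [tri] at this
    push_cast at this
    linarith
  refine lcmStep_of_left h (cell_a_b I) (x := x) ?_
  rw [List.singleton_append, normalForm_cons, hx]
  exact State.ext h₁ rfl rfl

theorem lcmStep_a_d (I : Set ℕ) {u v : List Gen} (h : normalForm (a :: u) = normalForm (d :: v)) :
    LcmStep I a d u v := by
  have hu := valid_normalForm u
  have hv := valid_normalForm v
  have h' := h
  simp only [normalForm_cons, act, State.mk.injEq] at h'
  obtain ⟨h₁, h₂, h₃⟩ := h'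
  obtain ⟨x, hx⟩ : ∃ x, normalForm x =
      ⟨(normalForm u).k, (normalForm u).w, (normalForm u).e - 1⟩ := by
    refine exists_normalForm_eq hu.isAC ?_
    have := hv.nonneg
    have h₄ := depth_a (normalForm u).k 0 (normalForm u).w
    rw [add_zero] at h₄
    rw [← h₂, ← h₁, h₄] at this
    push_cast at this
    linarith
  refine lcmStep_of_left h (cell_a_d I) (x := x) ?_
  rw [List.singleton_append, normalForm_cons, hx]
  exact State.ext rfl rfl (by simp [act])

theorem lcmStep_c_d (I : Set ℕ) {u v : List Gen} (h : normalForm (c :: u) = normalForm (d :: v)) :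
    LcmStep I c d u v := by
  have hu := valid_normalForm u
  have hv := valid_normalForm v
  have h' := h
  simp only [normalForm_cons, act, State.mk.injEq] at h'
  obtain ⟨h₁, h₂, h₃⟩ := h'
  obtain ⟨x, hx⟩ : ∃ x, normalForm x =
      ⟨(normalForm u).k, (normalForm u).w, (normalForm u).e - 1⟩ := by
    refine exists_normalForm_eq hu.isAC ?_
    have := hv.nonneg
    rw [← h₂, ← h₁, depth_c] at this
    push_cast at this
    linarith
  refine lcmStep_of_left h (cell_c_d I) (x := x) ?_
  rw [List.singleton_append, normalForm_cons, hx]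
  exact State.ext rfl rfl (by simp [act])

theorem lcmStep_b_c (I : Set ℕ) {u v : List Gen} (h : normalForm (b :: u) = normalForm (c :: v)) :
    LcmStep I b c u v := by
  have hu := valid_normalForm u
  have hv := valid_normalForm v
  have h' := h
  simp only [normalForm_cons, act, State.mk.injEq] at h'
  obtain ⟨h₁, h₂, h₃⟩ := h'
  obtain ⟨x, hx⟩ : ∃ x, normalForm x =
      ⟨(normalForm u).k, (normalForm v).w, (normalForm v).e - 1⟩ := by
    refine exists_normalForm_eq hv.isAC ?_
    have := hu.nonneg
    rw [h₂, h₃, ← h₁, depth_c] at this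
    push_cast at this
    linarith
  refine lcmStep_of_left h (cell_b_c I) (x := x) ?_
  rw [List.singleton_append, normalForm_cons, hx]
  refine State.ext rfl h₂ ?_
  simp only [act, h₃, ← h₁]
  push_cast
  ring

theorem normalForm_a_cons_ne_c_cons (u v : List Gen) :
    normalForm (a :: u) ≠ normalForm (c :: v) := by
  intro h
  simp [normalForm_cons, act] at h

/-- This is where the infinite family arises: `du' = bv'`-type equalities need not factor through
`bd = db`, because `v` has one more `b` than `u` and hence a possibly larger `depth`. -/
theorem lcmStep_b_d {I : Set ℕ} {u v : List Gen} (hI : ∀ n ≤ (b :: u).count a, n ∈ I)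
    (h : normalForm (b :: u) = normalForm (d :: v)) : LcmStep I b d u v := by
  have hu := valid_normalForm u
  have hv := valid_normalForm v
  have h' := h
  simp only [normalForm_cons, act, State.mk.injEq] at h'
  obtain ⟨h₁, h₂, h₃⟩ := h'
  -- The condition says that `u` can be divided by `d` within positive words.
  by_cases he : 0 ≤ (normalForm u).e - 1 + depth (normalForm u).k (normalForm u).w
  · obtain ⟨x, hx⟩ := exists_normalForm_eq hu.isAC he
    refine lcmStep_of_left h (cell_b_d I) (x := x) ?_
    rw [List.singleton_append, normalForm_cons, hx]
    exact State.ext rfl rfl (by simp [act])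
  · have hnu := hu.nonneg
    have hnv := hv.nonneg
    rw [← h₁, ← h₂] at hnv
    obtain ⟨n, y, hw⟩ := exists_block_of_depth_lt (k := (normalForm u).k) (w := (normalForm u).w)
      (by omega)
    have hd := depth_block (normalForm u).k n (c :: y)
    rw [depth_c, ← hw] at hd
    have hy : IsAC y := by
      have := hu.isAC
      rw [hw, isAC_append, isAC_cons] at this
      exact this.2.2
    -- The exponent restores the cost of `(ac)ⁿc` crossing `bᵏ`: `k` for the final `c` and `tri (k +
    -- 1)` for each `ac`.
    obtain ⟨x, hx⟩ := exists_normalForm_eq (k := (normalForm u).k)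
      (e := (normalForm u).e + (normalForm u).k + n * tri ((normalForm u).k + 1)) hy (by
        rw [hd] at hnu
        push_cast at hnu
        linarith)
    refine lcmStep_of_left h (cell_added (hI n ?_)) (x := x) ?_
    · have hcount := count_a_normalForm u
      rw [hw] at hcount
      rw [List.count_append, count_block] at hcount
      simp only [List.count_cons, beq_iff_eq, reduceCtorEq, if_false]
      omega
    · rw [normalForm_append, hx, actWord_append]
      simp only [actWord_cons, actWord_nil, act, actWord_block_one]
      exact State.ext rfl hw (by simp only; ring)

theorem lcmStep {I : Set ℕ} {s t : Gen} {u v : List Gen} (hI : ∀ n ≤ (s :: u).count a, n ∈ I)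
    (h : normalForm (s :: u) = normalForm (t :: v)) : LcmStep I s t u v := by
  have hI' : ∀ n ≤ (t :: v).count a, n ∈ I := by
    rw [← count_a_normalForm, h, count_a_normalForm] at hI
    exact hI
  by_cases hst : s = t
  · subst hst
    exact ⟨[], [], u, Or.inl ⟨rfl, rfl, rfl⟩, rfl, (act_injective s h).symm⟩
  · cases s <;> cases t
    · exact absurd rfl hst
    · exact lcmStep_a_b I h
    · exact absurd h (normalForm_a_cons_ne_c_cons u v)
    · exact lcmStep_a_d I h
    · exact (lcmStep_a_b I h.symm).symm
    · exact absurd rfl hst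
    · exact lcmStep_b_c I h
    · exact lcmStep_b_d hI h
    · exact absurd h.symm (normalForm_a_cons_ne_c_cons v u)
    · exact (lcmStep_b_c I h.symm).symm
    · exact absurd rfl hst
    · exact lcmStep_c_d I h
    · exact (lcmStep_a_d I h.symm).symm
    · exact (lcmStep_b_d hI' h.symm).symm
    · exact (lcmStep_c_d I h.symm).symm
    · exact absurd rfl hst

/-! ### Completeness, graded by the number of letters `a` -/

theorem weight_eq {u v : List Gen} (h : normalForm u = normalForm v) : weight u = weight v :=
  congrArg State.weight h

theorem weight_le_append (u v : List Gen) : weight v ≤ weight (u ++ v) := by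
  induction u with
  | nil => exact le_rfl
  | cons x u ih => exact ih.trans (weight_lt_cons x _).le

theorem count_a_eq {u v : List Gen} (h : normalForm u = normalForm v) : u.count a = v.count a := by
  rw [← count_a_normalForm, h, count_a_normalForm]

theorem normalForm_nil_ne_cons {x : Gen} {u : List Gen} : normalForm [] ≠ normalForm (x :: u) := by
  intro h
  have h₁ := weight_lt_cons x u
  rw [← weight_eq h] at h₁
  exact absurd h₁ (by simp [weight, State.weight, normalForm, depth])

/-- Words with the same normal form pass the reversing test as soon as enough of the added
relations are available. -/
theorem grid_of_normalForm_eq {I : Set ℕ} {u v : List Gen} (hI : ∀ n ≤ u.count a, n ∈ I)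
    (h : normalForm u = normalForm v) : Grid (relsUpTo I) u v [] [] := by
  induction hN : weight u using Nat.strong_induction_on generalizing u v with
  | _ N ih =>
    rcases u with _ | ⟨s, u⟩ <;> rcases v with _ | ⟨t, v⟩
    · exact Grid.nil_left _
    · exact absurd h normalForm_nil_ne_cons
    · exact absurd h.symm normalForm_nil_ne_cons
    · obtain ⟨p, q, x, hc, hu, hv⟩ := lcmStep hI h
      have hu_lt : weight u < N := hN ▸ weight_lt_cons s u
      have hv_lt : weight v < N := by
        rw [← hN, weight_eq h]
        exact weight_lt_cons t v
      have hIu : ∀ n ≤ u.count a, n ∈ I := fun n hn => hI n (hn.trans List.count_le_count_cons)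
      have hIv : ∀ n ≤ v.count a, n ∈ I := fun n hn =>
        hI n (by rw [count_a_eq h]; exact hn.trans List.count_le_count_cons)
      obtain ⟨x₁, v₁, y₁, g₁, g₁', e₁⟩ := Grid.right_append_iff.1 (ih _ hu_lt hIu hu rfl)
      obtain ⟨x₂, v₂, y₂, g₂, g₂', e₂⟩ := Grid.left_append_iff.1
        (ih _ (weight_eq hv ▸ hv_lt) (by rwa [← count_a_eq hv]) hv.symm rfl)
      obtain ⟨rfl, rfl⟩ := List.append_eq_nil_iff.1 e₁.symm
      obtain ⟨rfl, rfl⟩ := List.append_eq_nil_iff.1 e₂.symm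
      -- The remaining corner compares `v₁` with `x₂`. Both are equivalent to `x`, whose weight is
      -- at most that of `u`, so induction applies.
      refine Grid.cons_of_cell hc x₂ v₁ g₂ g₁ (ih _ ?_ ?_ ?_ rfl)
      · have := weight_eq g₁'.equivalent.normalForm_eq
        rw [List.append_nil, List.append_nil] at this
        rw [this]
        refine lt_of_le_of_lt (weight_le_append p x) ?_
        rwa [← weight_eq hu]
      · have := count_a_eq g₁'.equivalent.normalForm_eq
        rw [List.append_nil, List.append_nil] at this
        rw [this]
        intro n hn
        refine hIu n (hn.trans ?_)
        rw [count_a_eq hu, List.count_append]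
        exact Nat.le_add_left _ _
      · have h₁ := g₁'.equivalent.normalForm_eq
        have h₂ := g₂'.equivalent.normalForm_eq
        simp only [List.append_nil] at h₁ h₂
        exact h₁.trans h₂

theorem grid_univ_of_normalForm_eq {u v : List Gen} (h : normalForm u = normalForm v) :
    Grid (relsUpTo Set.univ) u v [] [] :=
  grid_of_normalForm_eq (fun _ _ => Set.mem_univ _) h

theorem relsUpTo_univ : relsUpTo Set.univ = baseRels ∪ Set.range addedRel := by
  simp [relsUpTo]

theorem rComplete_univ : RComplete (relsUpTo Set.univ) := fun _ _ h =>
  reverses_nil_iff.2 (grid_univ_of_normalForm_eq h.normalForm_eq)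

/-! ### The word problem and cancellativity of the monoid -/

/-- The chain is `b(ac)ⁿc = aⁿbc = aⁿdcb = daⁿcb`, so completion does not change the monoid. -/
theorem base_equivalent_addedRel (n : ℕ) :
    Equivalent baseRels (b :: (block 1 n ++ [c])) (d :: (List.replicate n a ++ [c, b])) := by
  have hd : ∀ n, Equivalent baseRels (List.replicate n a ++ [d]) (d :: List.replicate n a) := by
    intro n
    induction n with
    | zero => exact .refl _ _
    | succ n ih =>
      have h₁ := (Equivalent.refl baseRels [a]).append ih
      have h₂ : Equivalent baseRels [a, d] [d, a] := .of_mem (by simp [baseRels])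
      simpa [List.replicate_succ] using h₁.trans (h₂.append (.refl _ (List.replicate n a)))
  have hb : ∀ n, Equivalent baseRels (b :: block 1 n) (List.replicate n a ++ [b]) := by
    intro n
    induction n with
    | zero => exact .refl _ _
    | succ n ih =>
      have h₁ : Equivalent baseRels [b, a, c] [a, b] := .of_mem (by simp [baseRels])
      simpa [List.replicate_succ] using
        (h₁.append (.refl _ (block 1 n))).trans ((Equivalent.refl baseRels [a]).append ih)
  have h₁ : Equivalent baseRels [b, c] [d, c, b] :=
    .trans (.trans (v := [c, b, d]) (.of_mem (by simp [baseRels])) <|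
      (Equivalent.refl _ [c]).append (.of_mem (u := [b, d]) (v := [d, b]) (by simp [baseRels]))) <|
      (Equivalent.of_mem (u := [c, d]) (v := [d, c]) (by simp [baseRels])).append (.refl _ [b])
  have h₂ := (hb n).append (.refl _ [c])
  have h₃ := (Equivalent.refl baseRels (List.replicate n a)).append h₁
  have h₄ := (hd n).append (.refl _ [c, b])
  simp only [List.append_assoc, List.cons_append, List.nil_append] at h₂ h₃ h₄
  exact h₂.trans (h₃.trans h₄)

theorem Equivalent.base_of_relsUpTo {I : Set ℕ} {u v : List Gen}
    (h : Equivalent (relsUpTo I) u v) : Equivalent baseRels u v := by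
  suffices hle : conGen (toRel (relsUpTo I)) ≤ conGen (toRel baseRels) from hle h
  refine Con.conGen_le.2 fun x y hxy => ?_
  rcases hxy with h | ⟨n, -, h⟩
  · exact Equivalent.of_mem h
  · rw [addedRel_eq, Sym2.eq_iff] at h
    rcases h with ⟨h₁, h₂⟩ | ⟨h₁, h₂⟩
    · have := base_equivalent_addedRel n
      rw [h₁, h₂] at this
      exact this
    · have := (base_equivalent_addedRel n).symm
      rw [h₁, h₂] at this
      exact this

/-- Completeness of the full set of relations gives the converse: equal normal forms yield a grid,
and its cells hold in the base monoid. -/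
theorem base_equivalent_iff {u v : List Gen} :
    Equivalent baseRels u v ↔ normalForm u = normalForm v := by
  constructor
  · intro h
    rw [← relsUpTo_empty] at h
    exact h.normalForm_eq
  · intro h
    simpa using (grid_univ_of_normalForm_eq h).equivalent.base_of_relsUpTo

theorem presMonoid_mk_eq_iff {x y : FreeMonoid Gen} :
    PresentedMonoid.mk (toRel baseRels) x = PresentedMonoid.mk (toRel baseRels) y ↔
      normalForm x.toList = normalForm y.toList := by
  rw [← base_equivalent_iff]
  exact Con.eq (conGen (toRel baseRels))

theorem actWord_injective (u : List Gen) : Function.Injective (actWord u) := by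
  induction u with
  | nil => exact fun _ _ h => h
  | cons x u ih => exact (act_injective x).comp ih

theorem normalForm_append_right_cancel {u v : List Gen} (x : List Gen)
    (h : normalForm (u ++ x) = normalForm (v ++ x)) : normalForm u = normalForm v := by
  induction x generalizing u v with
  | nil => simpa using h
  | cons s x ih => exact normalForm_right_cancel s (ih (by simpa using h))

theorem isLeftCancelMul_presMonoid : IsLeftCancelMul (PresMonoid baseRels) := by
  refine ⟨fun x y z h => ?_⟩
  induction x using PresentedMonoid.inductionOn with | _ x
  induction y using PresentedMonoid.inductionOn with | _ y
  induction z using PresentedMonoid.inductionOn with | _ z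
  simp only [← map_mul, presMonoid_mk_eq_iff, FreeMonoid.toList_mul, normalForm_append] at h ⊢
  exact actWord_injective _ h

theorem isRightCancelMul_presMonoid : IsRightCancelMul (PresMonoid baseRels) := by
  refine ⟨fun x y z h => ?_⟩
  induction x using PresentedMonoid.inductionOn with | _ x
  induction y using PresentedMonoid.inductionOn with | _ y
  induction z using PresentedMonoid.inductionOn with | _ z
  simp only [← map_mul, presMonoid_mk_eq_iff, FreeMonoid.toList_mul] at h ⊢
  exact normalForm_append_right_cancel _ h

/-! ### Inversion of cells and grids -/

/-- The cells of `relsUpTo I`, listed according to the two letters. -/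
def CellSpec (I : Set ℕ) : Gen → Gen → List Gen → List Gen → Prop
  | a, b, p, q => p = [b] ∧ q = [a, c]
  | b, a, p, q => p = [a, c] ∧ q = [b]
  | a, d, p, q => p = [d] ∧ q = [a]
  | d, a, p, q => p = [a] ∧ q = [d]
  | b, c, p, q => p = [c] ∧ q = [b, d]
  | c, b, p, q => p = [b, d] ∧ q = [c]
  | c, d, p, q => p = [d] ∧ q = [c]
  | d, c, p, q => p = [c] ∧ q = [d]
  | b, d, p, q => (p = [d] ∧ q = [b]) ∨
      ∃ n ∈ I, p = block 1 n ++ [c] ∧ q = List.replicate n a ++ [c, b]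
  | d, b, p, q => (p = [b] ∧ q = [d]) ∨
      ∃ n ∈ I, p = List.replicate n a ++ [c, b] ∧ q = block 1 n ++ [c]
  | a, c, _, _ => False
  | c, a, _, _ => False
  | _, _, p, q => p = [] ∧ q = []

theorem Cell.spec {I : Set ℕ} {s t : Gen} {p q : List Gen} (h : Cell (relsUpTo I) s t p q) :
    CellSpec I s t p q := by
  rcases h with ⟨rfl, rfl, rfl⟩ | h | ⟨n, hn, h⟩
  · cases s <;> simp [CellSpec]
  · cases s <;> cases t <;> simp_all [CellSpec, baseRels]
  · rw [addedRel_eq, Sym2.eq_iff] at h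
    rcases h with ⟨h₁, h₂⟩ | ⟨h₁, h₂⟩ <;> obtain ⟨rfl, rfl⟩ := List.cons.inj h₁ <;>
      obtain ⟨rfl, rfl⟩ := List.cons.inj h₂ <;> exact .inr ⟨n, hn, rfl, rfl⟩

section Inversion

variable {I : Set ℕ}

/-- No relation has the same first letter on both sides, so the corner cell is the trivial one. -/
theorem grid_cons_same {s : Gen} {u v p q : List Gen}
    (h : Grid (relsUpTo I) (s :: u) (s :: v) p q) : Grid (relsUpTo I) u v p q := by
  obtain ⟨p₀, q₀, v₁, q₁, p₁, u₁, v₂, u₂, hc, g₁, g₂, g₃, rfl, rfl⟩ := Grid.cons_cons_iff.1 h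
  have : p₀ = [] ∧ q₀ = [] := by
    have := hc.spec
    cases s <;> exact this
  obtain ⟨rfl, rfl⟩ := this
  obtain ⟨rfl, rfl⟩ := Grid.nil_left_iff.1 g₁
  obtain ⟨rfl, rfl⟩ := Grid.nil_right_iff.1 g₂
  exact g₃

theorem grid_self {u p q : List Gen} (h : Grid (relsUpTo I) u u p q) : p = [] ∧ q = [] := by
  induction u with
  | nil => exact Grid.nil_left_iff.1 h
  | cons s u ih => exact ih (grid_cons_same h)

theorem grid_d_right {u p q : List Gen} (hu : IsAC u) (h : Grid (relsUpTo I) u [d] p q) :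
    p = [d] ∧ q = u := by
  induction u generalizing q with
  | nil => exact Grid.nil_left_iff.1 h
  | cons x u ih =>
    rw [← List.singleton_append] at h
    obtain ⟨y, x', y', h₁, h₂, rfl⟩ := Grid.left_append_iff.1 h
    have hs := (Grid.singleton_iff.1 h₁).spec
    obtain ⟨rfl, rfl⟩ : y = [d] ∧ x' = [x] := by
      rcases (isAC_cons.1 hu).1 with rfl | rfl <;> exact hs
    obtain ⟨rfl, rfl⟩ := ih (isAC_cons.1 hu).2 h₂
    exact ⟨rfl, rfl⟩

theorem grid_d_left {u p q : List Gen} (hu : IsAC u) (h : Grid (relsUpTo I) [d] u p q) :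
    p = u ∧ q = [d] := (grid_d_right hu h.symm).symm

theorem not_grid_a_c {u v p q : List Gen} : ¬ Grid (relsUpTo I) (a :: u) (c :: v) p q :=
  fun h => normalForm_a_cons_ne_c_cons _ _ h.equivalent.normalForm_eq

theorem not_grid_c_a {u v p q : List Gen} : ¬ Grid (relsUpTo I) (c :: u) (a :: v) p q :=
  fun h => not_grid_a_c h.symm

theorem isAC_block (n : ℕ) : IsAC (block 1 n) := by
  induction n with
  | zero => simp [IsAC]
  | succ n ih => simpa [isAC_cons] using ih

theorem isAC_block_c (n : ℕ) : IsAC (block 1 n ++ [c]) :=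
  isAC_append.2 ⟨isAC_block n, isAC_replicate_c 1⟩

/-- After cancelling common blocks, unequal exponents leave `a` facing `c`, a pair without common
right multiple. -/
theorem eq_of_grid_block {m n : ℕ} {u v p q : List Gen}
    (h : Grid (relsUpTo I) (block 1 m ++ c :: u) (block 1 n ++ c :: v) p q) : m = n := by
  induction m generalizing n with
  | zero =>
    cases n with
    | zero => rfl
    | succ n => exact absurd h (by simpa using not_grid_c_a)
  | succ m ih =>
    cases n with
    | zero => exact absurd h (by simpa using not_grid_a_c)
    | succ n =>
      simp only [block_succ, List.replicate_one, List.cons_append, List.nil_append] at h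
      rw [ih (grid_cons_same (grid_cons_same h))]

theorem eq_of_grid_replicate {m n : ℕ} {u v p q : List Gen}
    (h : Grid (relsUpTo I) (List.replicate m a ++ c :: u) (List.replicate n a ++ c :: v) p q) :
    m = n := by
  induction m generalizing n with
  | zero =>
    cases n with
    | zero => rfl
    | succ n => exact absurd h (by simpa [List.replicate_succ] using not_grid_c_a)
  | succ m ih =>
    cases n with
    | zero => exact absurd h (by simpa [List.replicate_succ] using not_grid_a_c)
    | succ n =>
      simp only [List.replicate_succ, List.cons_append] at h
      rw [ih (grid_cons_same h)]

theorem grid_b_replicate {n : ℕ} {p q : List Gen}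
    (h : Grid (relsUpTo I) [b] (List.replicate n a ++ [c, b]) p q) :
    p = block 1 n ++ [c] ∧ q = [d] := by
  induction n generalizing p with
  | zero =>
    obtain ⟨p₁, q₁, v₁, hc, g, rfl⟩ := Grid.singleton_cons_iff.1 h
    obtain ⟨rfl, rfl⟩ := hc.spec
    obtain ⟨rfl, rfl⟩ := Grid.nil_right_iff.1 (grid_cons_same g)
    exact ⟨rfl, rfl⟩
  | succ n ih =>
    rw [List.replicate_succ, List.cons_append] at h
    obtain ⟨p₁, q₁, v₁, hc, g, rfl⟩ := Grid.singleton_cons_iff.1 h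
    obtain ⟨rfl, rfl⟩ := hc.spec
    obtain ⟨rfl, rfl⟩ := ih g
    exact ⟨by simp, rfl⟩

end Inversion

/-! ### Evaluating concrete reversings -/

/-- Reversing with respect to the base relations, with bounded recursion depth. -/
def reverseBase : ℕ → List Gen → List Gen → Option (List Gen × List Gen)
  | _, [], v => some (v, [])
  | _, u, [] => some ([], u)
  | 0, _, _ => none
  | n + 1, s :: u, t :: v =>
    (match s, t with
      | a, b => some ([b], [a, c])
      | b, a => some ([a, c], [b])
      | b, c => some ([c], [b, d])
      | c, b => some ([b, d], [c])
      | a, c => none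
      | c, a => none
      | x, y => if x = y then some ([], []) else some ([y], [x])).bind fun pq =>
    (reverseBase n u pq.1).bind fun x =>
    (reverseBase n pq.2 v).bind fun y =>
    (reverseBase n x.2 y.1).bind fun z => some (x.1 ++ z.1, y.2 ++ z.2)

theorem grid_of_reverseBase (I : Set ℕ) {n : ℕ} {u v : List Gen} {pq : List Gen × List Gen}
    (h : reverseBase n u v = some pq) : Grid (relsUpTo I) u v pq.1 pq.2 := by
  induction n generalizing u v pq with
  | zero =>
    rcases u with _ | ⟨s, u⟩ <;> rcases v with _ | ⟨t, v⟩ <;> simp [reverseBase] at h <;> subst h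
    · exact Grid.nil_left _
    · exact Grid.nil_left _
    · exact Grid.nil_right _
  | succ n ih =>
    rcases u with _ | ⟨s, u⟩
    · simp only [reverseBase, Option.some.injEq] at h
      subst h
      exact Grid.nil_left _
    rcases v with _ | ⟨t, v⟩
    · simp only [reverseBase, Option.some.injEq] at h
      subst h
      exact Grid.nil_right _
    simp only [reverseBase, Option.bind_eq_some_iff, Option.some.injEq] at h
    obtain ⟨⟨p, q⟩, hc, x, hx, y, hy, z, hz, rfl⟩ := h
    refine Grid.cons_cons_iff.2 ⟨p, q, _, _, _, _, _, _, ?_, ih hy, ih hx, ih hz, rfl, rfl⟩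
    cases s <;> cases t <;> simp at hc <;> obtain ⟨rfl, rfl⟩ := hc
    · exact .inl ⟨rfl, rfl, rfl⟩
    · exact cell_a_b I
    · exact cell_a_d I
    · exact (cell_a_b I).symm
    · exact .inl ⟨rfl, rfl, rfl⟩
    · exact cell_b_c I
    · exact cell_b_d I
    · exact (cell_b_c I).symm
    · exact .inl ⟨rfl, rfl, rfl⟩
    · exact cell_c_d I
    · exact (cell_a_d I).symm
    · exact (cell_b_d I).symm
    · exact (cell_c_d I).symm
    · exact .inl ⟨rfl, rfl, rfl⟩

/-! ### Case analysis of the tests at stage `N` -/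

/-- The relation `su = tv` either passes its test with the added relations of index less than `N`,
or is the next added relation. -/
def TestOK (N : ℕ) (s t : Gen) (u v : List Gen) : Prop :=
  Grid (relsUpTo (Set.Iio N)) (s :: u) (t :: v) [] [] ∨ s(s :: u, t :: v) = addedRel N

theorem TestOK.symm {N : ℕ} {s t : Gen} {u v : List Gen} (h : TestOK N s t u v) :
    TestOK N t s v u := h.imp Grid.symm fun h => Sym2.eq_swap.trans h

theorem TestOK.of_eq {N : ℕ} {s t : Gen} {u v : List Gen} (h : s :: u = t :: v) :
    TestOK N s t u v := .inl (h ▸ Grid.refl _ _)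

theorem Cell.testOK {N : ℕ} {s t : Gen} {p q : List Gen}
    (h : Cell (relsUpTo (Set.Iio N)) s t p q) : TestOK N s t p q := by
  rcases h with ⟨rfl, rfl, rfl⟩ | h
  · exact .of_eq rfl
  · exact .inl (Grid.of_mem (by simp) (by simp) h)

/-- `q⁻¹ p₁` reverses to `p' q'⁻¹` between the cells of `s, r` and of `r, t`. -/
structure TestGrid (N : ℕ) (s r t : Gen) (p q p₁ q₁ p' q' : List Gen) : Prop where
  left : Cell (relsUpTo (Set.Iio N)) s r p q
  right : Cell (relsUpTo (Set.Iio N)) r t p₁ q₁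
  grid : Grid (relsUpTo (Set.Iio N)) q p₁ p' q'

namespace TestGrid

variable {N : ℕ} {p q p₁ q₁ p' q' : List Gen}

theorem symm {s r t : Gen} (h : TestGrid N s r t p q p₁ q₁ p' q') :
    TestGrid N t r s q₁ p₁ q p q' p' :=
  ⟨h.right.symm, h.left.symm, h.grid.symm⟩

theorem isTest {s r t : Gen} (h : TestGrid N s r t p q p₁ q₁ p' q') :
    IsTest (relsUpTo (Set.Iio N)) s r t (p ++ p') (q₁ ++ q') :=
  isTest_iff.2 ⟨_, _, _, _, _, _, h.right, h.left, h.grid, rfl, rfl⟩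

/-- Graded completeness disposes of every test with fewer than `N` letters `a`, so that most cases
reduce to a count. -/
theorem testOK_of_count {s r t : Gen} (h : TestGrid N s r t p q p₁ q₁ p' q')
    (hN : (s :: (p ++ p')).count a < N) : TestOK N s t (p ++ p') (q₁ ++ q') :=
  .inl (grid_of_normalForm_eq (fun _ hn => lt_of_le_of_lt hn hN)
    h.isTest.equivalent.normalForm_eq)

theorem testOK_left {s t : Gen} (h : TestGrid N s s t p q p₁ q₁ p' q') :
    TestOK N s t (p ++ p') (q₁ ++ q') := by
  have : p = [] ∧ q = [] := by
    have := h.left.spec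
    cases s <;> exact this
  obtain ⟨rfl, rfl⟩ := this
  obtain ⟨rfl, rfl⟩ := Grid.nil_left_iff.1 h.grid
  simpa using h.right.testOK

theorem testOK_same {s r : Gen} (h : TestGrid N s r s p q q p p' q') :
    TestOK N s s (p ++ p') (p ++ q') := by
  obtain ⟨rfl, rfl⟩ := grid_self h.grid
  exact .of_eq rfl

/-- Filling the inner `b, d` cell with `addedRel n` yields `addedRel (n + 1)`, which is new only
when `n + 1 = N`. -/
theorem testOK_b_a_d (h : TestGrid N b a d p q p₁ q₁ p' q') :
    TestOK N b d (p ++ p') (q₁ ++ q') := by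
  obtain ⟨rfl, rfl⟩ := h.left.spec
  obtain ⟨rfl, rfl⟩ := h.right.spec
  rcases (Grid.singleton_iff.1 h.grid).spec with ⟨rfl, rfl⟩ | ⟨n, hn, rfl, rfl⟩
  -- The relation is `bacd = dab`, checked by evaluation; `20` is merely a sufficient recursion
  -- bound.
  · exact .inl (grid_of_reverseBase _ (n := 20) (pq := ([], [])) rfl)
  · rcases (Nat.succ_le_of_lt hn).lt_or_eq with hN | rfl
    · exact h.testOK_of_count (by simpa using hN)
    · exact .inr (by simp [addedRel_eq, List.replicate_succ])

theorem testOK_a_b_d (h : TestGrid N a b d p q p₁ q₁ p' q') :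
    TestOK N a d (p ++ p') (q₁ ++ q') := by
  obtain ⟨rfl, rfl⟩ := h.left.spec
  rcases h.right.spec with ⟨rfl, rfl⟩ | ⟨n, hn, rfl, rfl⟩
  · obtain ⟨rfl, rfl⟩ := grid_d_right (by simp [IsAC]) h.grid
    exact .inl (grid_of_reverseBase _ (n := 20) (pq := ([], [])) rfl)
  · cases n with
    | zero => exact absurd h.grid not_grid_a_c
    | succ n =>
      have g := h.grid
      simp only [block_succ, List.replicate_one, List.cons_append, List.nil_append] at g
      obtain ⟨rfl, rfl⟩ := Grid.nil_left_iff.1 (grid_cons_same (grid_cons_same g))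
      exact h.testOK_of_count (by simpa using hn)

theorem testOK_c_b_d (h : TestGrid N c b d p q p₁ q₁ p' q') :
    TestOK N c d (p ++ p') (q₁ ++ q') := by
  obtain ⟨rfl, rfl⟩ := h.left.spec
  rcases h.right.spec with ⟨rfl, rfl⟩ | ⟨n, hn, rfl, rfl⟩
  · obtain ⟨rfl, rfl⟩ := grid_d_right (by simp [IsAC]) h.grid
    exact .inl (grid_of_reverseBase _ (n := 20) (pq := ([], [])) rfl)
  · cases n with
    | zero =>
      obtain ⟨rfl, rfl⟩ := grid_self h.grid
      exact h.testOK_of_count (by simpa using hn)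
    | succ n => exact absurd h.grid (by simpa using not_grid_c_a)

theorem testOK_d_b_d (h : TestGrid N d b d p q p₁ q₁ p' q') :
    TestOK N d d (p ++ p') (q₁ ++ q') := by
  rcases h.left.spec with ⟨rfl, rfl⟩ | ⟨n, hn, rfl, rfl⟩ <;>
    rcases h.right.spec with ⟨rfl, rfl⟩ | ⟨m, hm, rfl, rfl⟩
  · exact h.testOK_same
  · obtain ⟨rfl, rfl⟩ := grid_d_left (isAC_block_c m) h.grid
    exact h.testOK_of_count (by simpa using hm)
  · obtain ⟨rfl, rfl⟩ := grid_d_right (isAC_block_c n) h.grid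
    exact h.testOK_of_count (by simpa using hn)
  · obtain rfl := eq_of_grid_block h.grid
    exact h.testOK_same

/-- The choice `bd = db` in the inner cell yields `bc = dcb`, that is `addedRel 0`, the seed of the
family. -/
theorem testOK_b_c_d (h : TestGrid N b c d p q p₁ q₁ p' q') :
    TestOK N b d (p ++ p') (q₁ ++ q') := by
  obtain ⟨rfl, rfl⟩ := h.left.spec
  obtain ⟨rfl, rfl⟩ := h.right.spec
  obtain ⟨y, x', y', g₁, g₂, rfl⟩ := h.grid.split.2 [b] [d] rfl
  rcases (Grid.singleton_iff.1 g₁).spec with ⟨rfl, rfl⟩ | ⟨n, hn, rfl, rfl⟩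
  · obtain ⟨rfl, rfl⟩ := grid_self g₂
    rcases N.eq_zero_or_pos with rfl | hN
    · exact .inr rfl
    · exact h.testOK_of_count (by simpa using hN)
  · obtain ⟨rfl, rfl⟩ := grid_d_left (isAC_block_c n) g₂
    exact h.testOK_of_count (by simpa using hn)

theorem testOK_a_d_b (h : TestGrid N a d b p q p₁ q₁ p' q') :
    TestOK N a b (p ++ p') (q₁ ++ q') := by
  obtain ⟨rfl, rfl⟩ := h.left.spec
  rcases h.right.spec with ⟨rfl, rfl⟩ | ⟨n, hn, rfl, rfl⟩
  · obtain ⟨rfl, rfl⟩ := (Grid.singleton_iff.1 h.grid).spec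
    exact .inl (grid_of_reverseBase _ (n := 20) (pq := ([], [])) rfl)
  · cases n with
    | zero => exact absurd h.grid not_grid_a_c
    | succ n =>
      have g := h.grid
      rw [List.replicate_succ, List.cons_append] at g
      obtain ⟨rfl, rfl⟩ := Grid.nil_left_iff.1 (grid_cons_same g)
      exact h.testOK_of_count (by simpa using hn)

theorem testOK_c_d_b (h : TestGrid N c d b p q p₁ q₁ p' q') :
    TestOK N c b (p ++ p') (q₁ ++ q') := by
  obtain ⟨rfl, rfl⟩ := h.left.spec
  rcases h.right.spec with ⟨rfl, rfl⟩ | ⟨n, hn, rfl, rfl⟩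
  · obtain ⟨rfl, rfl⟩ := (Grid.singleton_iff.1 h.grid).spec
    exact .inl (grid_of_reverseBase _ (n := 20) (pq := ([], [])) rfl)
  · cases n with
    | zero =>
      obtain ⟨rfl, rfl⟩ := Grid.nil_left_iff.1 (grid_cons_same h.grid)
      exact h.testOK_of_count (by simpa using hn)
    | succ n => exact absurd h.grid (by simpa [List.replicate_succ] using not_grid_c_a)

theorem testOK_b_d_b (h : TestGrid N b d b p q p₁ q₁ p' q') :
    TestOK N b b (p ++ p') (q₁ ++ q') := by
  rcases h.left.spec with ⟨rfl, rfl⟩ | ⟨n, hn, rfl, rfl⟩ <;>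
    rcases h.right.spec with ⟨rfl, rfl⟩ | ⟨m, hm, rfl, rfl⟩
  · exact h.testOK_same
  · obtain ⟨rfl, rfl⟩ := grid_b_replicate h.grid
    exact h.testOK_of_count (by simpa using hm)
  · obtain ⟨rfl, rfl⟩ := grid_b_replicate h.grid.symm
    exact h.testOK_of_count (by simpa using hn)
  · obtain rfl := eq_of_grid_replicate h.grid
    exact h.testOK_same

theorem testOK {s r t : Gen} (h : TestGrid N s r t p q p₁ q₁ p' q') :
    TestOK N s t (p ++ p') (q₁ ++ q') := by
  have hl := h.left.spec
  have hr := h.right.spec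
  by_cases hsr : s = r
  · subst hsr
    exact h.testOK_left
  by_cases htr : t = r
  · subst htr
    exact h.symm.testOK_left.symm
  cases r
  · cases s <;> cases t <;> try contradiction
    · obtain ⟨rfl, rfl⟩ := hl
      obtain ⟨rfl, rfl⟩ := hr
      exact h.testOK_same
    · exact h.testOK_b_a_d
    · exact h.symm.testOK_b_a_d.symm
    · obtain ⟨rfl, rfl⟩ := hl
      obtain ⟨rfl, rfl⟩ := hr
      exact h.testOK_same
  · cases s <;> cases t <;> try contradiction
    · obtain ⟨rfl, rfl⟩ := hl
      obtain ⟨rfl, rfl⟩ := hr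
      exact h.testOK_same
    · obtain ⟨rfl, rfl⟩ := hl
      obtain ⟨rfl, rfl⟩ := hr
      exact absurd h.grid not_grid_a_c
    · exact h.testOK_a_b_d
    · obtain ⟨rfl, rfl⟩ := hl
      obtain ⟨rfl, rfl⟩ := hr
      exact absurd h.grid not_grid_c_a
    · obtain ⟨rfl, rfl⟩ := hl
      obtain ⟨rfl, rfl⟩ := hr
      exact h.testOK_same
    · exact h.testOK_c_b_d
    · exact h.symm.testOK_a_b_d.symm
    · exact h.symm.testOK_c_b_d.symm
    · exact h.testOK_d_b_d
  · cases s <;> cases t <;> try contradiction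
    · obtain ⟨rfl, rfl⟩ := hl
      obtain ⟨rfl, rfl⟩ := hr
      exact h.testOK_same
    · exact h.testOK_b_c_d
    · exact h.symm.testOK_b_c_d.symm
    · obtain ⟨rfl, rfl⟩ := hl
      obtain ⟨rfl, rfl⟩ := hr
      exact h.testOK_same
  · cases s <;> cases t <;> try contradiction
    · obtain ⟨rfl, rfl⟩ := hl
      obtain ⟨rfl, rfl⟩ := hr
      exact h.testOK_same
    · exact h.testOK_a_d_b
    · obtain ⟨rfl, rfl⟩ := hl
      obtain ⟨rfl, rfl⟩ := hr
      exact absurd h.grid not_grid_a_c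
    · exact h.symm.testOK_a_d_b.symm
    · exact h.testOK_b_d_b
    · exact h.symm.testOK_c_d_b.symm
    · obtain ⟨rfl, rfl⟩ := hl
      obtain ⟨rfl, rfl⟩ := hr
      exact absurd h.grid not_grid_c_a
    · exact h.testOK_c_d_b
    · obtain ⟨rfl, rfl⟩ := hl
      obtain ⟨rfl, rfl⟩ := hr
      exact h.testOK_same

end TestGrid

/-! ### Runs of the completion -/

theorem obstructions_subset (N : ℕ) :
    obstructions (relsUpTo (Set.Iio N)) ⊆ {addedRel N} := by
  rintro _ ⟨s, r, t, u, v, ht, hp, rfl⟩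
  obtain ⟨p₁, q₁, p, q, p', q', h₁, h₂, g, rfl, rfl⟩ := isTest_iff.1 ht
  rcases (TestGrid.mk h₂ h₁ g).testOK with h | h
  · exact absurd (passesTest_iff.2 h) hp
  · exact h

theorem relsUpTo_succ (N : ℕ) :
    relsUpTo (Set.Iio (N + 1)) = relsUpTo (Set.Iio N) ∪ {addedRel N} := by
  have : Set.Iio (N + 1) = insert N (Set.Iio N) := by
    ext n
    simp only [Set.mem_Iio, Set.mem_insert_iff]
    omega
  rw [relsUpTo, relsUpTo, this, Set.image_insert_eq, Set.union_assoc, Set.union_singleton]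

theorem isTest_addedRel_zero (I : Set ℕ) : IsTest (relsUpTo I) b c d [c] [c, b] :=
  isTest_iff.2 ⟨[d], [c], [c], [b, d], [], [b], cell_c_d I, cell_b_c I,
    grid_of_reverseBase I (n := 20) (pq := ([], [b])) rfl, rfl, rfl⟩

theorem isTest_addedRel_succ {I : Set ℕ} {n : ℕ} (hn : n ∈ I) : IsTest (relsUpTo I) b a d
    (block 1 (n + 1) ++ [c]) (List.replicate (n + 1) a ++ [c, b]) :=
  isTest_iff.2 ⟨[d], [a], [a, c], [b], _, _, cell_a_d I, (cell_a_b I).symm,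
    Grid.cell (cell_added hn), by simp, by simp [List.replicate_succ]⟩

/-- The corner cell of a successful grid cannot be `bd = db`, which would leave a `d` that never
disappears. It is thus some `addedRel m`, and comparing blocks gives `m = n`. -/
theorem mem_of_passesTest {I : Set ℕ} {n : ℕ} (h : PassesTest (relsUpTo I) b d
    (block 1 n ++ [c]) (List.replicate n a ++ [c, b])) : n ∈ I := by
  obtain ⟨p, q, v₁, q₁, p₁, u₁, v₂, u₂, hc, g₁, g₂, g₃, hp, hq⟩ :=
    Grid.cons_cons_iff.1 (passesTest_iff.1 h)
  obtain ⟨rfl, rfl⟩ := List.append_eq_nil_iff.1 hp.symm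
  rcases hc.spec with ⟨rfl, rfl⟩ | ⟨m, hm, rfl, rfl⟩
  · exact absurd (grid_d_right (isAC_block_c n) g₂).1 (by simp)
  · rwa [eq_of_grid_block g₂]

theorem addedRel_injective : Function.Injective addedRel := by
  intro m n h
  rw [addedRel_eq, addedRel_eq, Sym2.eq_iff] at h
  rcases h with ⟨h, -⟩ | ⟨h, -⟩
  · have := congrArg (List.count a) h
    simpa using this
  · simp at h

theorem addedRel_mem_iff {I : Set ℕ} {n : ℕ} : addedRel n ∈ relsUpTo I ↔ n ∈ I := by
  constructor
  · intro h
    rw [addedRel_eq] at h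
    exact mem_of_passesTest (passesTest_iff.2 (Grid.of_mem (by simp) (by simp) h))
  · exact fun h => .inr ⟨n, h, rfl⟩

/-- Each stage has at most one obstruction, so a run can only wait or add the next relation. -/
theorem IsCompletionRun.exists_eq_relsUpTo {P : ℕ → Rels Gen} (hP : IsCompletionRun baseRels P)
    (k : ℕ) : ∃ N, P k = relsUpTo (Set.Iio N) := by
  induction k with
  | zero => exact ⟨0, by simp [hP.zero, relsUpTo]⟩
  | succ k ih =>
    obtain ⟨N, hN⟩ := ih
    have h₁ := hP.mono k
    have h₂ := hP.step k
    rw [hN] at h₁ h₂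
    have h₂ := h₂.trans (Set.union_subset_union_right _ (obstructions_subset N))
    by_cases h : addedRel N ∈ P (k + 1)
    · refine ⟨N + 1, ?_⟩
      rw [relsUpTo_succ]
      exact h₂.antisymm (Set.union_subset h₁ (by simpa using h))
    · refine ⟨N, Set.Subset.antisymm (fun x hx => ?_) h₁⟩
      rcases h₂ hx with h' | rfl
      · exact h'
      · exact absurd hx h

theorem IsCompletionRun.exists_addedRel_mem {P : ℕ → Rels Gen}
    (hP : IsCompletionRun baseRels P) (n : ℕ) : ∃ k, addedRel n ∈ P k := by
  induction n with
  | zero =>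
    obtain ⟨N, hN⟩ := hP.exists_eq_relsUpTo 0
    obtain ⟨m, hm⟩ := hP.fair 0 b c d _ _ (hN ▸ isTest_addedRel_zero _)
    obtain ⟨M, hM⟩ := hP.exists_eq_relsUpTo m
    rw [hM] at hm
    exact ⟨m, hM ▸ addedRel_mem_iff.2 (mem_of_passesTest (n := 0) hm)⟩
  | succ n ih =>
    obtain ⟨k, hk⟩ := ih
    obtain ⟨N, hN⟩ := hP.exists_eq_relsUpTo k
    rw [hN, addedRel_mem_iff] at hk
    obtain ⟨m, hm⟩ := hP.fair k b a d _ _ (hN ▸ isTest_addedRel_succ hk)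
    obtain ⟨M, hM⟩ := hP.exists_eq_relsUpTo m
    rw [hM] at hm
    exact ⟨m, hM ▸ addedRel_mem_iff.2 (mem_of_passesTest hm)⟩

theorem IsCompletionRun.iUnion_eq {P : ℕ → Rels Gen} (hP : IsCompletionRun baseRels P) :
    ⋃ k, P k = relsUpTo Set.univ := by
  refine Set.Subset.antisymm (Set.iUnion_subset fun k => ?_) (Set.union_subset ?_ ?_)
  · obtain ⟨N, hN⟩ := hP.exists_eq_relsUpTo k
    rw [hN]
    exact relsUpTo_mono (Set.subset_univ _)
  · rw [← hP.zero]
    exact Set.subset_iUnion P 0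
  · rintro _ ⟨n, -, rfl⟩
    exact Set.mem_iUnion.2 (hP.exists_addedRel_mem n)

theorem iUnion_relsUpTo_Iio : ⋃ N : ℕ, relsUpTo (Set.Iio N) = relsUpTo Set.univ := by
  refine Set.Subset.antisymm
    (Set.iUnion_subset fun N => relsUpTo_mono (Set.subset_univ _)) (Set.union_subset ?_ ?_)
  · exact (base_subset _).trans (Set.subset_iUnion (fun N => relsUpTo (Set.Iio N)) 0)
  · rintro _ ⟨n, -, rfl⟩
    exact Set.mem_iUnion.2 ⟨n + 1, addedRel_mem_iff.2 (Nat.lt_succ_self n)⟩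

theorem addedRel_mem_obstructions (N : ℕ) :
    addedRel N ∈ obstructions (relsUpTo (Set.Iio N)) := by
  cases N with
  | zero => exact ⟨b, c, d, _, _, isTest_addedRel_zero _,
      fun h => lt_irrefl 0 (mem_of_passesTest (I := Set.Iio 0) (n := 0) h), addedRel_eq 0⟩
  | succ n => exact ⟨b, a, d, _, _, isTest_addedRel_succ (Nat.lt_succ_self n),
      fun h => lt_irrefl (n + 1) (mem_of_passesTest (I := Set.Iio (n + 1)) h), addedRel_eq (n + 1)⟩

theorem isCompletionRun_relsUpTo :
    IsCompletionRun baseRels fun N => relsUpTo (Set.Iio N) where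
  zero := by simp [relsUpTo]
  mono k := relsUpTo_mono (Set.Iio_subset_Iio (Nat.le_succ k))
  step k := by
    rw [relsUpTo_succ]
    exact Set.union_subset_union_right _
      (Set.singleton_subset_iff.2 (addedRel_mem_obstructions k))
  fair k s r t u v h := by
    -- A test relates equivalent words, so it passes with all the relations, hence already at some
    -- finite stage.
    have hg := grid_univ_of_normalForm_eq h.equivalent.normalForm_eq
    rw [← iUnion_relsUpTo_Iio] at hg
    obtain ⟨m, hm⟩ := hg.exists_of_iUnion fun i j hij => relsUpTo_mono (Set.Iio_subset_Iio hij)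
    exact ⟨m, passesTest_iff.2 hm⟩

theorem isSemigroupPresentation_baseRels : IsSemigroupPresentation baseRels := by
  intro u v h
  simp only [baseRels, Set.mem_insert_iff, Set.mem_singleton_iff, Sym2.eq_iff] at h
  rcases h with (⟨rfl, rfl⟩ | ⟨rfl, rfl⟩) | (⟨rfl, rfl⟩ | ⟨rfl, rfl⟩) |
      (⟨rfl, rfl⟩ | ⟨rfl, rfl⟩) | (⟨rfl, rfl⟩ | ⟨rfl, rfl⟩) | (⟨rfl, rfl⟩ | ⟨rfl, rfl⟩) <;> simp

theorem finite_gen : Finite Gen :=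
  Finite.of_injective (fun x : Gen => (decide (x = a), decide (x = b), decide (x = c))) (by
    intro x y
    cases x <;> cases y <;> simp)

end WordReversing

theorem mainTheorem12 :
    -- the presentation is a finite, homogeneous semigroup presentation
    Finite Gen ∧ baseRels.Finite ∧ IsSemigroupPresentation baseRels ∧ Homogeneous baseRels ∧
    -- every run of the completion procedure yields the same set, namely the announced one
    (∀ Q : Rels Gen, IsRCompletion baseRels Q ↔ Q = baseRels ∪ Set.range addedRel) ∧
    -- this R-completion is infinite and R-complete
    (baseRels ∪ Set.range addedRel).Infinite ∧
    RComplete (baseRels ∪ Set.range addedRel) ∧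
    -- the monoid is left and right cancellative
    IsLeftCancelMul (PresMonoid baseRels) ∧ IsRightCancelMul (PresMonoid baseRels) := by
  refine ⟨finite_gen, by simp [baseRels], isSemigroupPresentation_baseRels,
    relsUpTo_empty ▸ homogeneous_relsUpTo ∅, fun Q => ?_, ?_, relsUpTo_univ ▸ rComplete_univ,
    isLeftCancelMul_presMonoid, isRightCancelMul_presMonoid⟩
  · rw [← relsUpTo_univ]
    constructor
    · rintro ⟨P, hP, rfl⟩
      exact hP.iUnion_eq
    · rintro rfl
      exact ⟨_, isCompletionRun_relsUpTo, iUnion_relsUpTo_Iio.symm⟩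
  · exact (Set.infinite_range_of_injective addedRel_injective).mono Set.subset_union_right
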